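/- Let $\mathbb{K}$ be either the real line $\mathbb{R}$ or the circle $\mathbb{S}=[0,1)$ (functions of period $1$), and let $H^s(\mathbb{K})$, for $s$ a nonnegative integer, be the Sobolev space of real-valued functions with norm $\|f\|_{H^s}^2=\sum_{j=0}^s\|\partial_x^j f\|_{L^2(\mathbb{K})}^2$. Let $n\ge 1$ be an integer, let $0<T\le\infty$, and let $u\in C^0([0,T);H^{n+2}(\mathbb{K}))\cap C^1([0,T);H^{n+1}(\mathbb{K}))$ be a solution on $[0,T)$ of $$u_t-u_{txx}=\partial_x(2-\partial_x)(1+\partial_x)u^2 .$$ For $0\le m\le n$ and $t\in[0,T)$ put $$k_m(t)=\max_{0\le j\le m}\|\partial_x^j u(t,\cdot)\|_{L^\infty(\mathbb{K})},\qquad I_m(t)=\int_{\mathbb{K}}\frac12\sum_{j=0}^m\big(\partial_x^j u(t,x)\big)^2\,dx .$$ Suppose that for some $m\in\{1,\dots,n\}$ $$\int_0^t k_m(\tau)\,d\tau<\infty\qquad\text{for every finite } t \text{ with } 0\le t\le T .$$ Then for every $N\in\{0,\dots,n\}$ one has $\|u(t,\cdot)\|_{H^N}^2=2I_N(t)$ for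 all $t\in[0,T)$, and $I_N$ stays finite up to every finite time, that is, $$\sup_{0\le\tau<t}I_N(\tau)<\infty\qquad\text{for every finite } t \text{ with } 0<t\le T$$ (in particular, if $T<\infty$, then $I_N$ is bounded on $[0,T)$). -/

import Mathlib

open MeasureTheory Set
open scoped ContDiff

/-- The spatial domain `𝕂`: the real line, or the circle `𝕊 = [0,1)`. -/
inductive SpatialDomain
  | line
  | circle

namespace SpatialDomain

/-- Lebesgue measure on `𝕂`. In the periodic case functions on `𝕂` are functions on one period
`[0,1)`, up to null sets. -/
noncomputable def measure : SpatialDomain → Measure ℝ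
  | line => volume
  | circle => volume.restrict (Ico 0 1)

/-- Test functions on `𝕂`: smooth and compactly supported on the line, smooth and `1`-periodic on
the circle. -/
def IsTest : SpatialDomain → (ℝ → ℝ) → Prop
  | line, φ => ContDiff ℝ ∞ φ ∧ HasCompactSupport φ
  | circle, φ => ContDiff ℝ ∞ φ ∧ Function.Periodic φ 1

end SpatialDomain

/-- The real Hilbert space `L²(𝕂)`. -/
abbrev L2 (K : SpatialDomain) : Type := Lp ℝ 2 K.measure

/-- `g` is the `j`-th weak (distributional) derivative of `f` on `𝕂`. -/
def IsWeakDeriv (K : SpatialDomain) (j : ℕ) (f g : L2 K) : Prop :=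
  ∀ φ : ℝ → ℝ, K.IsTest φ →
    ∫ x, f x * iteratedDeriv j φ x ∂K.measure = (-1) ^ j * ∫ x, g x * φ x ∂K.measure

theorem SpatialDomain.IsTest.memLp_iteratedDeriv {K : SpatialDomain} {φ : ℝ → ℝ}
    (hφ : K.IsTest φ) (j : ℕ) : MemLp (iteratedDeriv j φ) 2 K.measure := by
  cases K with
  | line =>
    obtain ⟨h1, h2⟩ := hφ
    have hc : Continuous (iteratedDeriv j φ) :=
      h1.continuous_iteratedDeriv j (by exact_mod_cast le_top)
    have hs : HasCompactSupport (iteratedDeriv j φ) := by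
      clear hc
      induction j with
      | zero => simpa using h2
      | succ k ih =>
        rw [iteratedDeriv_succ]
        exact ih.deriv
    exact hc.memLp_of_hasCompactSupport (μ := volume) hs
  | circle =>
    obtain ⟨h1, -⟩ := hφ
    have hc : Continuous (iteratedDeriv j φ) :=
      h1.continuous_iteratedDeriv j (by exact_mod_cast le_top)
    obtain ⟨C, hC⟩ := (isCompact_Icc (a := (0 : ℝ)) (b := 1)).exists_bound_of_continuousOn
      hc.continuousOn
    have : IsFiniteMeasure (SpatialDomain.circle.measure) := by
      unfold SpatialDomain.measure
      infer_instance
    refine MemLp.of_bound hc.aestronglyMeasurable C ?_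
    unfold SpatialDomain.measure
    filter_upwards [ae_restrict_mem measurableSet_Ico] with x hx
    exact hC x (Ico_subset_Icc_self hx)

theorem L2.integrable_mul_test {K : SpatialDomain} (f : L2 K) {φ : ℝ → ℝ}
    (hφ : K.IsTest φ) (j : ℕ) : Integrable (fun x => f x * iteratedDeriv j φ x) K.measure :=
  (Lp.memLp f).integrable_mul (hφ.memLp_iteratedDeriv j)

theorem L2.integrable_mul_test' {K : SpatialDomain} (f : L2 K) {φ : ℝ → ℝ}
    (hφ : K.IsTest φ) : Integrable (fun x => f x * φ x) K.measure := by
  simpa using f.integrable_mul_test hφ 0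

theorem IsWeakDeriv.add {K : SpatialDomain} {j : ℕ} {f g f' g' : L2 K}
    (h : IsWeakDeriv K j f g) (h' : IsWeakDeriv K j f' g') :
    IsWeakDeriv K j (f + f') (g + g') := by
  intro φ hφ
  have e1 : ∫ x, (f + f' : L2 K) x * iteratedDeriv j φ x ∂K.measure
      = ∫ x, (f x * iteratedDeriv j φ x + f' x * iteratedDeriv j φ x) ∂K.measure := by
    refine integral_congr_ae ?_
    filter_upwards [Lp.coeFn_add f f'] with x hx
    rw [hx, Pi.add_apply, add_mul]
  have e2 : ∫ x, (g + g' : L2 K) x * φ x ∂K.measure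
      = ∫ x, (g x * φ x + g' x * φ x) ∂K.measure := by
    refine integral_congr_ae ?_
    filter_upwards [Lp.coeFn_add g g'] with x hx
    rw [hx, Pi.add_apply, add_mul]
  rw [e1, e2, integral_add (f.integrable_mul_test hφ j) (f'.integrable_mul_test hφ j),
    integral_add (g.integrable_mul_test' hφ) (g'.integrable_mul_test' hφ), h φ hφ, h' φ hφ]
  ring

theorem IsWeakDeriv.smul {K : SpatialDomain} {j : ℕ} {f g : L2 K} (c : ℝ)
    (h : IsWeakDeriv K j f g) : IsWeakDeriv K j (c • f) (c • g) := by
  intro φ hφ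
  have e1 : ∫ x, (c • f : L2 K) x * iteratedDeriv j φ x ∂K.measure
      = ∫ x, c * (f x * iteratedDeriv j φ x) ∂K.measure := by
    refine integral_congr_ae ?_
    filter_upwards [Lp.coeFn_smul c f] with x hx
    rw [hx, Pi.smul_apply, smul_eq_mul, mul_assoc]
  have e2 : ∫ x, (c • g : L2 K) x * φ x ∂K.measure = ∫ x, c * (g x * φ x) ∂K.measure := by
    refine integral_congr_ae ?_
    filter_upwards [Lp.coeFn_smul c g] with x hx
    rw [hx, Pi.smul_apply, smul_eq_mul, mul_assoc]
  rw [e1, e2, integral_const_mul, integral_const_mul, h φ hφ]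
  ring

theorem IsWeakDeriv.zero (K : SpatialDomain) (j : ℕ) : IsWeakDeriv K j 0 0 := by
  intro φ hφ
  have e1 : ∫ x, (0 : L2 K) x * iteratedDeriv j φ x ∂K.measure = 0 := by
    refine integral_eq_zero_of_ae ?_
    filter_upwards [Lp.coeFn_zero ℝ 2 K.measure] with x hx
    rw [hx]
    simp
  have e2 : ∫ x, (0 : L2 K) x * φ x ∂K.measure = 0 := by
    refine integral_eq_zero_of_ae ?_
    filter_upwards [Lp.coeFn_zero ℝ 2 K.measure] with x hx
    rw [hx]
    simp
  rw [e1, e2, mul_zero]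

/-- The Sobolev space `H^s(𝕂)`, `s = 0, 1, 2, …`. An element is recorded with its weak derivatives
`(f, ∂ₓf, …, ∂ₓˢf)`, all in `L²(𝕂)`; they are determined by `f`. The norm inherited from the
`ℓ²`-product is `‖f‖²_{H^s} = ∑_{j ≤ s} ‖∂ₓʲf‖²_{L²}`. -/
noncomputable def sobolevSubmodule (K : SpatialDomain) (s : ℕ) :
    Submodule ℝ (PiLp 2 (fun _ : Fin (s + 1) => L2 K)) where
  carrier := {F | ∀ j : Fin (s + 1), IsWeakDeriv K j (F 0) (F j)}
  add_mem' ha hb j := (ha j).add (hb j)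
  zero_mem' j := IsWeakDeriv.zero K j
  smul_mem' c _ h j := (h j).smul c

/-- The Sobolev space `H^s(𝕂)` as a normed space. -/
abbrev Sobolev (K : SpatialDomain) (s : ℕ) : Type := sobolevSubmodule K s

namespace Sobolev

variable {K : SpatialDomain}

/-- The derivative `∂ₓʲ f ∈ L²(𝕂)` of `f ∈ H^s(𝕂)`, `0 ≤ j ≤ s`. -/
noncomputable def dx {s : ℕ} (f : Sobolev K s) (j : Fin (s + 1)) : L2 K := f.1 j

/-- The inclusion `H^s(𝕂) ⊆ H^r(𝕂)` for `r ≤ s`. -/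
noncomputable def incl {r s : ℕ} (h : r ≤ s) : Sobolev K s →ₗ[ℝ] Sobolev K r where
  toFun f := ⟨WithLp.toLp 2 fun j => f.dx (Fin.castLE (by omega) j),
    fun j => f.2 (Fin.castLE (by omega) j)⟩
  map_add' _ _ := rfl
  map_smul' _ _ := rfl

/-- `max_{0 ≤ j ≤ m} ‖∂ₓʲ f‖_{L^∞(𝕂)}`, with values in `[0,∞]`. -/
noncomputable def maxNorm {m : ℕ} (f : Sobolev K m) : ENNReal :=
  ⨆ j : Fin (m + 1), eLpNorm (f.dx j) ⊤ K.measure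

/-- `∫_𝕂 J_N(x) dx`, where `J_N = ½ ∑_{j ≤ N} (∂ₓʲ f)²`. -/
noncomputable def energy {N : ℕ} (f : Sobolev K N) : ℝ :=
  ∫ x, (1 / 2 : ℝ) * ∑ j : Fin (N + 1), (f.dx j x) ^ 2 ∂K.measure

end Sobolev

/-- The time interval `[0,T)`, where `T` may be `∞`. -/
def timeInterval (T : EReal) : Set ℝ := {t | 0 ≤ t ∧ (t : EReal) < T}

/-- The equation `v - ∂ₓ²v = ∂ₓ(2 - ∂ₓ)(1 + ∂ₓ) f² = 2∂ₓ(f²) + ∂ₓ²(f²) - ∂ₓ³(f²)` in `L²(𝕂)`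
(here `q = f²`). -/
def SpatialEquation {K : SpatialDomain} {s : ℕ} (f : Sobolev K s) (v : Sobolev K 2) : Prop :=
  ∃ q : Sobolev K 3, (q.dx 0 =ᵐ[K.measure] fun x => (f.dx 0 x) ^ 2) ∧
    v.dx 0 - v.dx 2 = (2 : ℝ) • q.dx 1 + q.dx 2 - q.dx 3

/-- `u ∈ C⁰([0,T); H^{n+2}(𝕂)) ∩ C¹([0,T); H^{n+1}(𝕂))` solves
`u_t - u_{txx} = ∂ₓ(2 - ∂ₓ)(1 + ∂ₓ) u²` on `[0,T)`; the time derivative is taken in `H^{n+1}(𝕂)`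
(one-sided at `t = 0`). -/
structure IsSolution (K : SpatialDomain) (n : ℕ) (hn : 1 ≤ n) (T : EReal)
    (u : ℝ → Sobolev K (n + 2)) : Prop where
  continuousOn : ContinuousOn u (timeInterval T)
  contDiffOn : ContDiffOn ℝ 1
    (fun t => Sobolev.incl (show n + 1 ≤ n + 2 by omega) (u t)) (timeInterval T)
  equation : ∀ t ∈ timeInterval T,
    SpatialEquation (u t) (Sobolev.incl (show 2 ≤ n + 1 by omega)
      (derivWithin (fun τ => Sobolev.incl (show n + 1 ≤ n + 2 by omega) (u τ))
        (timeInterval T) t))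

/-! The proof is an energy method. Write `f i` for the `i`-th derivative of `u(t)`, `v i` for that
of `u_t`, and `Q k` for the `k`-th derivative of `u²`. Differentiating the equation `j` times,
multiplying by `f j` and integrating by parts gives `∫ f j * v j + ∫ f (j+1) * v (j+1) = 2 ∫ Q (j+1)
* f j - ∫ Q (j+1) * f (j+1) + ∫ Q (j+2) * f (j+1)`, and twice the left side is the time derivative
of `‖f j‖² + ‖f (j+1)‖²`.

By Leibniz the right side is a sum of cubic integrals `∫ f a * f b * f c`. Only `f 0 * f (j+2) * f
(j+1)` has a factor of order above `j+1`; it equals `f 0` times half the derivative of `(f (j+1))²`,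
so a further integration by parts leaves `f 1 * (f (j+1))²`. In the other terms, if `a` or `b` is at
most `1`, that factor is bounded by the sup norms of `u` and `u_x`. Otherwise both lie between `2`
and `j`; one goes into `L^∞` by the embedding of `H¹`, the other is already bounded in `L²`
(`abs_integral_triple_le`). Hence the right side is at most quadratic in the energy norm, with
coefficient a multiple of `κ + 2B`, where `κ` is dominated by `2 k_m` and `B` comes from lower
orders (`energy_estimate`).

Grönwall with an integrable coefficient raises the bounded order from `j` to `j+1`; starting with `j
= 0`, where no earlier bound is needed, this reaches order `n`. The equation holds only in the weak
sense, so the calculus of `H¹` (primitives, product rule, integration by parts, uniqueness,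
embedding) is established beforehand. -/

open Filter Topology

/-! ### Fundamental domains and test functions -/

namespace SpatialDomain

/-- A closed fundamental domain: the line itself, or the closed period interval. -/
def dom : SpatialDomain → Set ℝ
  | line => univ
  | circle => Icc 0 1

/-- The boundary condition on the fundamental domain: none on the line, periodicity on the
circle. -/
def Matches : SpatialDomain → (ℝ → ℝ) → Prop
  | line, _ => True
  | circle, F => F 0 = F 1

variable {K : SpatialDomain}

theorem measure_eq_restrict_dom (K : SpatialDomain) : K.measure = volume.restrict K.dom := by
  cases K with
  | line => simp [measure, dom]
  | circle => simpa [measure, dom] using (restrict_Ico_eq_restrict_Icc : _ = _)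

theorem measurableSet_dom (K : SpatialDomain) : MeasurableSet K.dom := by
  cases K
  · exact MeasurableSet.univ
  · exact measurableSet_Icc

instance ordConnected_dom (K : SpatialDomain) : K.dom.OrdConnected := by
  cases K
  · exact ordConnected_univ
  · exact ordConnected_Icc

/-- Unit intervals serve for averaging in the Sobolev embedding, with a constant independent of the
point. -/
theorem exists_unit_interval {x : ℝ} (hx : x ∈ K.dom) :
    ∃ a : ℝ, x ∈ Icc a (a + 1) ∧ Icc a (a + 1) ⊆ K.dom := by
  cases K with
  | line => exact ⟨x, by simp, subset_univ _⟩
  | circle => exact ⟨0, by simpa [dom] using hx, by simp [dom]⟩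

instance isLocallyFiniteMeasure_measure (K : SpatialDomain) :
    IsLocallyFiniteMeasure K.measure := by
  rw [measure_eq_restrict_dom]
  infer_instance

theorem IsTest.contDiff {φ : ℝ → ℝ} (h : K.IsTest φ) : ContDiff ℝ ∞ φ := by
  cases K <;> exact h.1

theorem IsTest.deriv {φ : ℝ → ℝ} (h : K.IsTest φ) : K.IsTest (deriv φ) := by
  have h1 : ContDiff ℝ ∞ (_root_.deriv φ) := by
    have := h.contDiff
    rw [contDiff_infty_iff_deriv] at this
    exact this.2
  cases K with
  | line => exact ⟨h1, h.2.deriv⟩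
  | circle =>
    refine ⟨h1, fun x => ?_⟩
    have : (fun y => φ (y + 1)) = φ := funext h.2
    rw [← deriv_comp_add_const, this]

theorem IsTest.mul {φ ψ : ℝ → ℝ} (h : K.IsTest φ) (h' : K.IsTest ψ) :
    K.IsTest (fun x => φ x * ψ x) := by
  cases K with
  | line => exact ⟨h.1.mul h'.1, h.2.mul_right⟩
  | circle => exact ⟨h.1.mul h'.1, h.2.mul h'.2⟩

theorem IsTest.sub {φ ψ : ℝ → ℝ} (h : K.IsTest φ) (h' : K.IsTest ψ) :
    K.IsTest (fun x => φ x - ψ x) := by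
  cases K with
  | line => exact ⟨h.1.sub h'.1, h.2.sub h'.2⟩
  | circle => exact ⟨h.1.sub h'.1, h.2.sub h'.2⟩

theorem IsTest.const_mul {φ : ℝ → ℝ} (h : K.IsTest φ) (c : ℝ) :
    K.IsTest (fun x => c * φ x) := by
  cases K with
  | line => exact ⟨contDiff_const.mul h.1, h.2.mul_left⟩
  | circle => exact ⟨contDiff_const.mul h.1, fun x => by simp [h.2 x]⟩

theorem IsTest.memLp {φ : ℝ → ℝ} (h : K.IsTest φ) : MemLp φ 2 K.measure := by
  simpa using h.memLp_iteratedDeriv 0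

theorem IsTest.exists_bound {φ : ℝ → ℝ} (h : K.IsTest φ) : ∃ C, ∀ x, ‖φ x‖ ≤ C := by
  cases K with
  | line => exact h.1.continuous.bounded_above_of_compact_support h.2
  | circle =>
    obtain ⟨C, hC⟩ := (isCompact_Icc (a := (0 : ℝ)) (b := 1)).exists_bound_of_continuousOn
      h.1.continuous.continuousOn
    refine ⟨C, fun x => ?_⟩
    obtain ⟨y, hy, hxy⟩ := h.2.exists_mem_Ico₀ one_pos x
    rw [hxy]
    exact hC y (Ico_subset_Icc_self hy)

theorem IsTest.differentiable {φ : ℝ → ℝ} (h : K.IsTest φ) : Differentiable ℝ φ :=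
  h.contDiff.differentiable (by simp)

theorem IsTest.matches {φ : ℝ → ℝ} (h : K.IsTest φ) : K.Matches φ := by
  cases K with
  | line => trivial
  | circle => have := h.2 0; simp only [zero_add] at this; exact this.symm

theorem Matches.mul {F G : ℝ → ℝ} (h : K.Matches F) (h' : K.Matches G) :
    K.Matches (fun x => F x * G x) := by
  cases K with
  | line => trivial
  | circle => simp only [Matches] at *; rw [h, h']

/-- Local integrability is the right generality: on the line, a primitive of an `L²` function is
continuous but not a priori in `L²`. -/
theorem _root_.MeasureTheory.LocallyIntegrable.integrable_mul_isTest {h φ : ℝ → ℝ}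
    (hh : LocallyIntegrable h K.measure) (hφ : K.IsTest φ) :
    Integrable (fun x => h x * φ x) K.measure := by
  cases K with
  | line =>
    simpa [smul_eq_mul, mul_comm] using
      hh.integrable_smul_left_of_hasCompactSupport hφ.1.continuous hφ.2
  | circle =>
    obtain ⟨C, hC⟩ := hφ.exists_bound
    have h1 : Integrable h circle.measure := by
      have h2 := hh.integrableOn_isCompact (isCompact_Icc (a := (0 : ℝ)) (b := 1))
      rw [IntegrableOn, measure_eq_restrict_dom] at h2
      rw [measure_eq_restrict_dom]
      simpa [dom] using h2
    exact h1.mul_bdd hφ.contDiff.continuous.aestronglyMeasurable (ae_of_all _ hC)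

/-- A smooth function supported inside the period interval, extended periodically. -/
theorem isTest_comp_fract {g : ℝ → ℝ} (hg : ContDiff ℝ ∞ g) (hs : tsupport g ⊆ Ioo 0 1) :
    circle.IsTest (fun x => g (Int.fract x)) := by
  refine ⟨contDiff_iff_contDiffAt.2 fun x => ?_, fun x => by simp⟩
  have hz : ∀ y : ℝ, y ∉ Ioo (0 : ℝ) 1 → g =ᶠ[𝓝 y] 0 := fun y hy =>
    notMem_tsupport_iff_eventuallyEq.1 fun h => hy (hs h)
  by_cases hx : Int.fract x = 0
  -- At an integer the fractional part jumps from near `1` to `0`, but `g` vanishes near both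
  -- values, so the extension is locally zero.
  · have hx' : ((⌊x⌋ : ℤ) : ℝ) = x := by rw [Int.fract] at hx; linarith
    have h0 := hz 0 (by simp)
    have h1 := hz 1 (by simp)
    have e0 : ∀ᶠ y in 𝓝 x, g (y - ⌊x⌋) = 0 := by
      have : Tendsto (fun y : ℝ => y - ⌊x⌋) (𝓝 x) (𝓝 0) := by
        have : Tendsto (fun y : ℝ => y - ⌊x⌋) (𝓝 x) (𝓝 (x - ⌊x⌋)) :=
          (continuous_id.sub continuous_const).tendsto x
        simpa [hx'] using this
      exact this.eventually h0
    have e1 : ∀ᶠ y in 𝓝 x, g (y - ⌊x⌋ + 1) = 0 := by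
      have : Tendsto (fun y : ℝ => y - ⌊x⌋ + 1) (𝓝 x) (𝓝 1) := by
        have : Tendsto (fun y : ℝ => y - ⌊x⌋ + 1) (𝓝 x) (𝓝 (x - ⌊x⌋ + 1)) :=
          ((continuous_id.sub continuous_const).add continuous_const).tendsto x
        simpa [hx'] using this
      exact this.eventually h1
    have e2 : ∀ᶠ y in 𝓝 x, y ∈ Ioo (x - 1) (x + 1) :=
      Ioo_mem_nhds (by linarith) (by linarith)
    have : (fun y => g (Int.fract y)) =ᶠ[𝓝 x] fun _ => 0 := by
      filter_upwards [e0, e1, e2] with y h0 h1 h2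
      rcases lt_or_ge y x with hy | hy
      · have : ⌊y⌋ = ⌊x⌋ - 1 := by
          rw [Int.floor_eq_iff]; push_cast; constructor <;> linarith [h2.1]
        rw [Int.fract, this]; push_cast
        rw [← h1]; congr 1; ring
      · have : ⌊y⌋ = ⌊x⌋ := by
          rw [Int.floor_eq_iff]; constructor <;> linarith [h2.2]
        rw [Int.fract, this, h0]
    exact contDiffAt_const.congr_of_eventuallyEq this
  · have hpos : 0 < Int.fract x := lt_of_le_of_ne (Int.fract_nonneg x) (Ne.symm hx)
    have e : (fun y => g (Int.fract y)) =ᶠ[𝓝 x] fun y => g (y - ⌊x⌋) := by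
      have : ∀ᶠ y in 𝓝 x, y ∈ Ioo (⌊x⌋ : ℝ) (⌊x⌋ + 1) :=
        Ioo_mem_nhds (by rw [Int.fract] at hpos; linarith) (Int.lt_floor_add_one x)
      filter_upwards [this] with y hy
      have : ⌊y⌋ = ⌊x⌋ := by rw [Int.floor_eq_iff]; exact ⟨hy.1.le, hy.2⟩
      rw [Int.fract, this]
    refine ContDiffAt.congr_of_eventuallyEq ?_ e
    exact (hg.comp (contDiff_id.sub contDiff_const)).contDiffAt

/-- The fundamental lemma of the calculus of variations on `𝕂`. -/
theorem ae_eq_zero_of_integral_mul_isTest {h : ℝ → ℝ} (hh : LocallyIntegrable h K.measure)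
    (H : ∀ φ, K.IsTest φ → ∫ x, h x * φ x ∂K.measure = 0) : h =ᵐ[K.measure] 0 := by
  cases K with
  | line =>
    refine ae_eq_zero_of_integral_contDiff_smul_eq_zero hh fun g hg hg' => ?_
    simpa [mul_comm] using H g ⟨hg, hg'⟩
  | circle =>
    have h1 : LocallyIntegrableOn h (Ioo 0 1) volume := by
      have : LocallyIntegrableOn h (Icc 0 1) volume := by
        refine locallyIntegrableOn_of_locallyIntegrable_restrict ?_
        simpa [measure_eq_restrict_dom, dom] using hh
      exact this.mono_set Ioo_subset_Icc_self
    have h2 := isOpen_Ioo.ae_eq_zero_of_integral_contDiff_smul_eq_zero h1 fun g hg hg' hs => by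
      have h3 := H _ (isTest_comp_fract hg hs)
      simp only [measure] at h3
      have h4 : ∫ x in Ico (0 : ℝ) 1, h x * g (Int.fract x) = ∫ x in Ico (0 : ℝ) 1, g x • h x :=
        setIntegral_congr_fun measurableSet_Ico fun x hx => by
          simp only [Int.fract_eq_self.2 ⟨hx.1, hx.2⟩, smul_eq_mul, mul_comm]
      rw [h4, setIntegral_eq_integral_of_forall_compl_eq_zero] at h3
      · exact h3
      · intro x hx
        have : x ∉ tsupport g := fun h => hx (Ioo_subset_Ico_self (hs h))
        simp [image_eq_zero_of_notMem_tsupport this]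
    have h5 : ∀ᵐ x ∂(volume.restrict (Ioo (0 : ℝ) 1)), h x = 0 :=
      (ae_restrict_iff' measurableSet_Ioo).2 h2
    simp only [measure]
    rw [restrict_Ico_eq_restrict_Ioc, ← restrict_Ioo_eq_restrict_Ioc]
    exact h5

end SpatialDomain

/-! ### Primitives of test functions and vanishing weak derivatives -/

namespace SpatialDomain

variable {K : SpatialDomain}

theorem hasDerivAt_integral_of_contDiff {ψ : ℝ → ℝ} (h : ContDiff ℝ ∞ ψ) (a x : ℝ) :
    HasDerivAt (fun y => ∫ z in a..y, ψ z) (ψ x) x :=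
  intervalIntegral.integral_hasDerivAt_right (h.continuous.intervalIntegrable _ _)
    h.continuous.aestronglyMeasurable.stronglyMeasurableAtFilter h.continuous.continuousAt

theorem contDiff_integral_of_contDiff {ψ : ℝ → ℝ} (h : ContDiff ℝ ∞ ψ) (a : ℝ) :
    ContDiff ℝ ∞ (fun y => ∫ z in a..y, ψ z) := by
  have hd := hasDerivAt_integral_of_contDiff h a
  rw [contDiff_infty_iff_deriv]
  refine ⟨fun x => (hd x).differentiableAt, ?_⟩
  rwa [show deriv (fun y => ∫ z in a..y, ψ z) = ψ from funext fun x => (hd x).deriv]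

/-- A test function of mean zero is the derivative of a test function. -/
theorem IsTest.exists_deriv_eq {ψ : ℝ → ℝ} (h : K.IsTest ψ) (h0 : ∫ x, ψ x ∂K.measure = 0) :
    ∃ φ, K.IsTest φ ∧ _root_.deriv φ = ψ := by
  cases K with
  | line =>
    obtain ⟨R, hR⟩ := h.2.isCompact.isBounded.subset_closedBall 0
    have hz : ∀ x, R < |x| → ψ x = 0 := fun x hx => image_eq_zero_of_notMem_tsupport fun h' => by
      have := hR h'
      rw [mem_closedBall_zero_iff, Real.norm_eq_abs] at this
      linarith
    refine ⟨fun x => ∫ z in (-R)..x, ψ z, ⟨contDiff_integral_of_contDiff h.1 _,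
      HasCompactSupport.intro (isCompact_Icc (a := -R) (b := R)) fun x hx => ?_⟩,
      funext fun x => (hasDerivAt_integral_of_contDiff h.1 _ x).deriv⟩
    -- Left of `-R` the integrand vanishes; right of `R` the integral already contains the whole
    -- support, so the mean-zero condition applies.
    rcases lt_or_ge x (-R) with h1 | h1
    · rw [intervalIntegral.integral_symm, neg_eq_zero]
      refine intervalIntegral.integral_zero_ae ?_
      rw [uIoc_of_le h1.le]
      filter_upwards [Measure.ae_ne volume (-R)] with z hz' hzm
      have : z < -R := lt_of_le_of_ne hzm.2 hz'
      exact hz z (by rw [lt_abs]; right; linarith)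
    · have h2 : R < x := by
        by_contra h2
        exact hx ⟨h1, not_lt.1 h2⟩
      rcases lt_or_ge x 0 with h3 | h3
      · have : ∀ z, ψ z = 0 := fun z => hz z (by linarith [abs_nonneg z])
        simp [this]
      rw [intervalIntegral.integral_of_le h1]
      rw [setIntegral_eq_integral_of_forall_compl_eq_zero]
      · simpa [measure] using h0
      · intro z hz'
        by_cases h4 : z ≤ -R
        · rcases eq_or_lt_of_le h4 with h5 | h5
          -- The endpoint `-R` itself is covered by continuity from the left.
          · subst h5
            by_contra h6
            have hc := h.1.continuous.continuousAt (x := -R)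
            have h7 : ∀ᶠ y in 𝓝 (-R), ψ y ≠ 0 := hc.eventually_ne h6
            obtain ⟨y, hy1, hy2⟩ := (h7.filter_mono nhdsWithin_le_nhds |>.and
              (self_mem_nhdsWithin : Iio (-R) ∈ 𝓝[<] (-R))).exists
            exact hy1 (hz y (by rw [lt_abs]; right; linarith))
          · exact hz z (by rw [lt_abs]; right; linarith)
        · have : x < z := by
            by_contra h6
            exact hz' ⟨not_le.1 h4, not_lt.1 h6⟩
          exact hz z (by rw [lt_abs]; left; linarith)
  | circle =>
    have hi : ∀ a b, IntervalIntegrable ψ volume a b := fun a b =>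
      h.1.continuous.intervalIntegrable a b
    have h1 : ∫ z in (0 : ℝ)..1, ψ z = 0 := by
      rw [intervalIntegral.integral_of_le zero_le_one, ← restrict_Ico_eq_restrict_Ioc]
      exact h0
    refine ⟨fun x => ∫ z in (0 : ℝ)..x, ψ z, ⟨contDiff_integral_of_contDiff h.1 _, fun x => ?_⟩,
      funext fun x => (hasDerivAt_integral_of_contDiff h.1 _ x).deriv⟩
    have h2 := h.2.intervalIntegral_add_eq x 0
    rw [zero_add, h1] at h2
    simp only
    rw [← intervalIntegral.integral_add_adjacent_intervals (hi 0 x) (hi x (x + 1)), h2, add_zero]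

theorem exists_isTest_integral_eq_one (K : SpatialDomain) :
    ∃ ρ, K.IsTest ρ ∧ ∫ x, ρ x ∂K.measure = 1 := by
  cases K with
  | line =>
    let b : ContDiffBump (0 : ℝ) := ⟨1, 2, one_pos, one_lt_two⟩
    exact ⟨b.normed volume, ⟨b.contDiff_normed, b.hasCompactSupport_normed⟩,
      (b.integral_normed : ∫ x, b.normed volume x = 1)⟩
  | circle =>
    exact ⟨fun _ => 1, ⟨contDiff_const, fun _ => rfl⟩, by simp [measure]⟩

theorem IsTest.integrable {φ : ℝ → ℝ} (h : K.IsTest φ) : Integrable φ K.measure := by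
  have := (locallyIntegrable_const (1 : ℝ) (μ := K.measure)).integrable_mul_isTest h
  simpa using this

/-- A function with vanishing weak derivative is constant. -/
theorem ae_eq_const_of_integral_mul_deriv {h : ℝ → ℝ} (hh : LocallyIntegrable h K.measure)
    (H : ∀ φ, K.IsTest φ → ∫ x, h x * deriv φ x ∂K.measure = 0) :
    ∃ c : ℝ, h =ᵐ[K.measure] fun _ => c := by
  obtain ⟨ρ, hρ, hρ1⟩ := K.exists_isTest_integral_eq_one
  refine ⟨∫ x, h x * ρ x ∂K.measure, ?_⟩
  set c := ∫ x, h x * ρ x ∂K.measure with hc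
  have key := ae_eq_zero_of_integral_mul_isTest (K := K) (h := fun x => h x - c)
    (hh.sub (locallyIntegrable_const c)) fun ψ hψ => by
      -- Subtracting the multiple of `ρ` with the same integral makes `ψ` mean-zero, hence a
      -- derivative; testing with it gives `∫ h ψ = c ∫ ψ`.
      obtain ⟨φ, hφ, hφ'⟩ := (hψ.sub (hρ.const_mul (∫ x, ψ x ∂K.measure))).exists_deriv_eq (by
        rw [integral_sub hψ.integrable (hρ.integrable.const_mul _), integral_const_mul, hρ1]
        ring)
      have h1 := H φ hφ
      rw [hφ'] at h1
      have h2 : ∀ x, h x * (ψ x - (∫ x, ψ x ∂K.measure) * ρ x)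
          = h x * ψ x - (∫ x, ψ x ∂K.measure) * (h x * ρ x) := fun x => by ring
      simp_rw [h2] at h1
      rw [integral_sub (hh.integrable_mul_isTest hψ) ((hh.integrable_mul_isTest hρ).const_mul _),
        integral_const_mul] at h1
      simp_rw [sub_mul]
      rw [integral_sub (hh.integrable_mul_isTest hψ) (hψ.integrable.const_mul _),
        integral_const_mul, ← h1]
      ring
  filter_upwards [key] with x hx
  simpa [sub_eq_zero] using hx

theorem intervalIntegrable_of_locallyIntegrable {g : ℝ → ℝ} (hg : LocallyIntegrable g K.measure)
    {a b : ℝ} (ha : a ∈ K.dom) (hb : b ∈ K.dom) : IntervalIntegrable g volume a b := by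
  have h1 : uIcc a b ⊆ K.dom := K.ordConnected_dom.uIcc_subset ha hb
  have h2 := hg.integrableOn_isCompact (isCompact_uIcc (a := a) (b := b))
  rw [IntegrableOn, measure_eq_restrict_dom, Measure.restrict_restrict measurableSet_uIcc,
    inter_eq_left.2 h1] at h2
  exact IntegrableOn.intervalIntegrable h2

/-- If `h` has a primitive `P` on `𝕂` that is integrable and satisfies the boundary condition, then
the integral of `h` vanishes. -/
theorem integral_eq_zero_of_primitive {h P : ℝ → ℝ} (hh : Integrable h K.measure)
    (hP : Integrable P K.measure) (hm : K.Matches P)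
    (H : ∀ a ∈ K.dom, ∀ b ∈ K.dom, ∫ x in a..b, h x = P b - P a) :
    ∫ x, h x ∂K.measure = 0 := by
  cases K with
  | line =>
    simp only [measure, dom, mem_univ, true_imp_iff] at *
    -- Integrability of `h` makes `P` converge at infinity, and integrability of `P` forces the
    -- limit to be `0`.
    have top : Tendsto P atTop (𝓝 0) := by
      have h1 := intervalIntegral_tendsto_integral_Ioi 0 hh.integrableOn tendsto_id
      have h2 : Tendsto P atTop (𝓝 ((∫ x in Ioi (0 : ℝ), h x) + P 0)) := by
        refine (h1.add_const (P 0)).congr fun x => ?_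
        rw [H]; simp
      have : (∫ x in Ioi (0 : ℝ), h x) + P 0 = 0 := by
        refine IntegrableAtFilter.eq_zero_of_tendsto (l := atTop) (μ := volume) (f := P)
          (hP.integrableAtFilter _) (fun s hs => ?_) h2
        obtain ⟨b, hb⟩ := mem_atTop_sets.1 hs
        exact top_le_iff.1 (Real.volume_Ici (a := b) ▸ measure_mono (fun x hx => hb x hx))
      rwa [this] at h2
    have bot : Tendsto P atBot (𝓝 0) := by
      have h1 := intervalIntegral_tendsto_integral_Iic 0 hh.integrableOn tendsto_id
      have h2 : Tendsto P atBot (𝓝 (P 0 - (∫ x in Iic (0 : ℝ), h x))) := by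
        refine (h1.const_sub (P 0)).congr fun x => ?_
        rw [H]; simp
      have : P 0 - (∫ x in Iic (0 : ℝ), h x) = 0 := by
        refine IntegrableAtFilter.eq_zero_of_tendsto (l := atBot) (μ := volume) (f := P)
          (hP.integrableAtFilter _) (fun s hs => ?_) h2
        obtain ⟨b, hb⟩ := mem_atBot_sets.1 hs
        exact top_le_iff.1 (Real.volume_Iic (a := b) ▸ measure_mono (fun x hx => hb x hx))
      rwa [this] at h2
    have h3 := intervalIntegral_tendsto_integral hh tendsto_neg_atTop_atBot tendsto_id
    have h4 : Tendsto (fun x => P x - P (-x)) atTop (𝓝 (0 - 0)) :=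
      top.sub (bot.comp tendsto_neg_atTop_atBot)
    rw [sub_zero] at h4
    exact tendsto_nhds_unique (h3.congr fun x => by rw [H]; rfl) h4
  | circle =>
    have := H 0 (by simp [dom]) 1 (by simp [dom])
    rw [intervalIntegral.integral_of_le zero_le_one, ← restrict_Ico_eq_restrict_Ioc, ← hm,
      sub_self] at this
    exact this

end SpatialDomain

/-! ### Calculus of weak derivatives in `H¹` -/

/-- The product rule for primitives of integrable functions on an interval. -/
theorem intervalIntegral.integral_mul_add_mul_of_primitive {f g F G : ℝ → ℝ} {a b : ℝ}
    (hf : IntervalIntegrable f volume a b) (hg : IntervalIntegrable g volume a b)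
    (hF : ∀ x ∈ uIcc a b, F x = F a + ∫ y in a..x, f y)
    (hG : ∀ x ∈ uIcc a b, G x = G a + ∫ y in a..x, g y) :
    ∫ x in a..b, (f x * G x + F x * g x) = F b * G b - F a * G a := by
  -- Primitives of integrable functions are absolutely continuous, and integration by parts holds
  -- for such functions with almost-everywhere derivatives.
  have ac : ∀ {f : ℝ → ℝ} (c : ℝ), IntervalIntegrable f volume a b →
      AbsolutelyContinuousOnInterval (fun x => c + ∫ y in a..x, f y) a b := fun {f} c hf =>
    (LipschitzOnWith.absolutelyContinuousOnInterval (f := fun _ => c)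
      (LipschitzWith.const c).lipschitzOnWith).add
      (hf.absolutelyContinuousOnInterval_intervalIntegral left_mem_uIcc)
  have key := (ac (F a) hf).integral_deriv_mul_eq_sub (ac (G a) hg)
  rw [← hF b right_mem_uIcc, ← hG b right_mem_uIcc] at key
  simp only [intervalIntegral.integral_same, add_zero] at key
  rw [← key]
  refine intervalIntegral.integral_congr_ae ?_
  filter_upwards [hf.ae_hasDerivAt_integral, hg.ae_hasDerivAt_integral] with x h1 h2 hx
  have hx := uIoc_subset_uIcc hx
  rw [((h1 hx a left_mem_uIcc).const_add (F a)).deriv,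
    ((h2 hx a left_mem_uIcc).const_add (G a)).deriv, hF x hx, hG x hx]

/-- `f` and `g` are square integrable on `𝕂` and `g` is the weak derivative of `f`. -/
structure HasWeakDeriv (K : SpatialDomain) (f g : ℝ → ℝ) : Prop where
  memLp : MemLp f 2 K.measure
  memLp_deriv : MemLp g 2 K.measure
  integral_eq : ∀ φ, K.IsTest φ →
    ∫ x, f x * deriv φ x ∂K.measure = -∫ x, g x * φ x ∂K.measure

theorem MeasureTheory.MemLp.locallyIntegrable_two {K : SpatialDomain} {f : ℝ → ℝ}
    (hf : MemLp f 2 K.measure) : LocallyIntegrable f K.measure :=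
  hf.locallyIntegrable one_le_two

namespace HasWeakDeriv

variable {K : SpatialDomain} {f g f' g' : ℝ → ℝ}

theorem congr (h : HasWeakDeriv K f g) (h1 : f =ᵐ[K.measure] f') (h2 : g =ᵐ[K.measure] g') :
    HasWeakDeriv K f' g' where
  memLp := (memLp_congr_ae h1).1 h.memLp
  memLp_deriv := (memLp_congr_ae h2).1 h.memLp_deriv
  integral_eq φ hφ := by
    rw [← integral_congr_ae (h1.mono fun x hx => by simp only [hx] :
        (fun x => f x * deriv φ x) =ᵐ[K.measure] fun x => f' x * deriv φ x),
      ← integral_congr_ae (h2.mono fun x hx => by simp only [hx] :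
        (fun x => g x * φ x) =ᵐ[K.measure] fun x => g' x * φ x)]
    exact h.integral_eq φ hφ

theorem integrable_mul_isTest {φ : ℝ → ℝ} (hf : MemLp f 2 K.measure) (hφ : K.IsTest φ) :
    Integrable (fun x => f x * φ x) K.measure :=
  hf.integrable_mul hφ.memLp

theorem add (h : HasWeakDeriv K f f') (h' : HasWeakDeriv K g g') :
    HasWeakDeriv K (fun x => f x + g x) (fun x => f' x + g' x) where
  memLp := h.memLp.add h'.memLp
  memLp_deriv := h.memLp_deriv.add h'.memLp_deriv
  integral_eq φ hφ := by
    simp_rw [add_mul]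
    rw [integral_add (integrable_mul_isTest h.memLp hφ.deriv)
      (integrable_mul_isTest h'.memLp hφ.deriv), integral_add
      (integrable_mul_isTest h.memLp_deriv hφ) (integrable_mul_isTest h'.memLp_deriv hφ),
      h.integral_eq φ hφ, h'.integral_eq φ hφ]
    ring

theorem const_mul (c : ℝ) (h : HasWeakDeriv K f f') :
    HasWeakDeriv K (fun x => c * f x) (fun x => c * f' x) where
  memLp := h.memLp.const_mul c
  memLp_deriv := h.memLp_deriv.const_mul c
  integral_eq φ hφ := by
    simp_rw [mul_assoc]
    rw [integral_const_mul, integral_const_mul, h.integral_eq φ hφ]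
    ring

theorem sub (h : HasWeakDeriv K f f') (h' : HasWeakDeriv K g g') :
    HasWeakDeriv K (fun x => f x - g x) (fun x => f' x - g' x) := by
  simpa [sub_eq_add_neg] using h.add (h'.const_mul (-1))

theorem sum {ι : Type*} (s : Finset ι) {f f' : ι → ℝ → ℝ}
    (h : ∀ i ∈ s, HasWeakDeriv K (f i) (f' i)) :
    HasWeakDeriv K (fun x => ∑ i ∈ s, f i x) (fun x => ∑ i ∈ s, f' i x) := by
  classical
  induction s using Finset.induction_on with
  | empty =>
    simp only [Finset.sum_empty]
    exact ⟨MemLp.zero', MemLp.zero', fun φ _ => by simp⟩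
  | insert a s ha ih =>
    simp_rw [Finset.sum_insert ha]
    exact (h a (by simp)).add (ih fun i hi => h i (by simp [hi]))

/-- The weak derivative is unique. -/
theorem unique (h : HasWeakDeriv K f g) (h' : HasWeakDeriv K f' g') (hf : f =ᵐ[K.measure] f') :
    g =ᵐ[K.measure] g' := by
  have h1 := h.congr hf (ae_eq_refl g)
  have := SpatialDomain.ae_eq_zero_of_integral_mul_isTest (K := K) (h := fun x => g x - g' x)
    (h.memLp_deriv.locallyIntegrable_two.sub h'.memLp_deriv.locallyIntegrable_two) fun φ hφ => by
      simp_rw [sub_mul]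
      rw [integral_sub (integrable_mul_isTest h.memLp_deriv hφ)
        (integrable_mul_isTest h'.memLp_deriv hφ)]
      have e1 := h1.integral_eq φ hφ
      have e2 := h'.integral_eq φ hφ
      linarith
  filter_upwards [this] with x hx
  simpa [sub_eq_zero] using hx

/-- A function with square integrable weak derivative is a primitive of this derivative. -/
theorem exists_primitive (h : HasWeakDeriv K f g) :
    ∃ F : ℝ → ℝ, F =ᵐ[K.measure] f ∧ K.Matches F ∧
      ∀ a ∈ K.dom, ∀ b ∈ K.dom, F b = F a + ∫ x in a..b, g x := by
  -- Cutting off outside the fundamental domain makes the primitive `G` defined and continuous on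
  -- all of `ℝ`.
  set g₀ := K.dom.indicator g with hg₀
  have hg₀m : MemLp g₀ 2 volume := by
    rw [hg₀, memLp_indicator_iff_restrict K.measurableSet_dom,
      ← SpatialDomain.measure_eq_restrict_dom]
    exact h.memLp_deriv
  have hi : ∀ a b, IntervalIntegrable g₀ volume a b := fun a b =>
    ((hg₀m.locallyIntegrable one_le_two).integrableOn_isCompact isCompact_uIcc).intervalIntegrable
  set G : ℝ → ℝ := fun x => ∫ y in (0 : ℝ)..x, g₀ y with hG
  have hGc : Continuous G := intervalIntegral.continuous_primitive hi 0
  have hGl : LocallyIntegrable G K.measure := hGc.locallyIntegrable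
  have hGab : ∀ a b, G b = G a + ∫ y in a..b, g₀ y := fun a b =>
    (intervalIntegral.integral_add_adjacent_intervals (hi 0 a) (hi a b)).symm
  have hgg : ∀ a ∈ K.dom, ∀ b ∈ K.dom, ∀ x ∈ uIcc a b, g₀ x = g x := fun a ha b hb x hx =>
    indicator_of_mem (K.ordConnected_dom.uIcc_subset ha hb hx) g
  have hgi : ∀ a ∈ K.dom, ∀ b ∈ K.dom, ∫ x in a..b, g₀ x = ∫ x in a..b, g x :=
    fun a ha b hb => intervalIntegral.integral_congr (hgg a ha b hb)
  have hGm : K.Matches G := by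
    cases K with
    | line => trivial
    | circle =>
      -- On the circle the constant `1` is a test function, so `g` has mean zero and its primitive
      -- is periodic.
      have h1 := h.integral_eq (fun _ => 1) ⟨contDiff_const, fun _ => rfl⟩
      simp only [deriv_const, mul_zero, integral_zero, mul_one, SpatialDomain.measure] at h1
      have h2 := hgi 0 (by simp [SpatialDomain.dom]) 1 (by simp [SpatialDomain.dom])
      rw [intervalIntegral.integral_of_le (f := g) zero_le_one, ← restrict_Ico_eq_restrict_Ioc] at h2
      simp only [SpatialDomain.Matches, hG]
      rw [h2, intervalIntegral.integral_same]
      linarith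
  have hGd : ∀ φ, K.IsTest φ → ∫ x, (g x * φ x + G x * deriv φ x) ∂K.measure = 0 := by
    intro φ hφ
    refine SpatialDomain.integral_eq_zero_of_primitive (P := fun x => G x * φ x)
      ((integrable_mul_isTest h.memLp_deriv hφ).add (hGl.integrable_mul_isTest hφ.deriv))
      (hGl.integrable_mul_isTest hφ) (hGm.mul hφ.matches) fun a ha b hb => ?_
    have hφd : ∀ x ∈ uIcc a b, φ x = φ a + ∫ y in a..x, deriv φ y := fun x _ => by
      rw [intervalIntegral.integral_deriv_eq_sub (fun y _ => hφ.differentiable y)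
        (hφ.deriv.contDiff.continuous.intervalIntegrable _ _)]
      ring
    rw [← intervalIntegral.integral_mul_add_mul_of_primitive (hi a b)
      (hφ.deriv.contDiff.continuous.intervalIntegrable _ _) (fun x _ => hGab a x) hφd]
    exact intervalIntegral.integral_congr fun x hx => by simp only [hgg a ha b hb x hx]
  -- Both `f` and `G` have weak derivative `g`, so their difference is constant.
  obtain ⟨c, hc⟩ := SpatialDomain.ae_eq_const_of_integral_mul_deriv (K := K)
    (h := fun x => f x - G x) (h.memLp.locallyIntegrable_two.sub hGl) fun φ hφ => by
      have e1 := hGd φ hφ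
      rw [integral_add (integrable_mul_isTest h.memLp_deriv hφ)
        (hGl.integrable_mul_isTest hφ.deriv)] at e1
      simp_rw [sub_mul]
      rw [integral_sub (integrable_mul_isTest h.memLp hφ.deriv)
        (hGl.integrable_mul_isTest hφ.deriv), h.integral_eq φ hφ]
      linarith
  refine ⟨fun x => c + G x, ?_, ?_, fun a ha b hb => ?_⟩
  · filter_upwards [hc] with x hx
    linarith
  · cases K with
    | line => trivial
    | circle => exact congrArg (c + ·) hGm
  · simp only
    rw [← hgi a ha b hb, hGab a b, add_assoc]

/-- Integration by parts on `𝕂`. -/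
theorem integral_mul_add_mul (h : HasWeakDeriv K f f') (h' : HasWeakDeriv K g g') :
    ∫ x, f' x * g x ∂K.measure + ∫ x, f x * g' x ∂K.measure = 0 := by
  obtain ⟨F, hF, hFm, hFd⟩ := h.exists_primitive
  obtain ⟨G, hG, hGm, hGd⟩ := h'.exists_primitive
  have i1 := h.memLp_deriv.integrable_mul h'.memLp
  have i2 := h.memLp.integrable_mul h'.memLp_deriv
  have i3 := h.memLp.integrable_mul h'.memLp
  have e : (fun x => f' x * G x + F x * g' x) =ᵐ[K.measure]
      fun x => f' x * g x + f x * g' x := by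
    filter_upwards [hF, hG] with x h1 h2
    rw [h1, h2]
  have e3 : (fun x => F x * G x) =ᵐ[K.measure] fun x => f x * g x := by
    filter_upwards [hF, hG] with x h1 h2
    rw [h1, h2]
  have := SpatialDomain.integral_eq_zero_of_primitive (K := K)
    (h := fun x => f' x * G x + F x * g' x) (P := fun x => F x * G x)
    ((integrable_congr e).2 (i1.add i2)) ((integrable_congr e3).2 i3) (hFm.mul hGm)
    fun a ha b hb => by
      have hs := K.ordConnected_dom.uIcc_subset ha hb
      exact intervalIntegral.integral_mul_add_mul_of_primitive
        (SpatialDomain.intervalIntegrable_of_locallyIntegrable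
          h.memLp_deriv.locallyIntegrable_two ha hb)
        (SpatialDomain.intervalIntegrable_of_locallyIntegrable
          h'.memLp_deriv.locallyIntegrable_two ha hb)
        (fun x hx => hFd a ha x (hs hx)) (fun x hx => hGd a ha x (hs hx))
  rw [integral_congr_ae e] at this
  rw [← this]
  exact (integral_add i1 i2).symm

/-- On an interval of length one Lebesgue measure is a probability measure, so the `L¹` norm is at
most the `L²` norm. -/
theorem integral_abs_Icc_le {a : ℝ} (hf : MemLp f 2 K.measure) (ha : Icc a (a + 1) ⊆ K.dom) :
    IntegrableOn f (Icc a (a + 1)) ∧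
      ∫ x in Icc a (a + 1), |f x| ≤ (eLpNorm f 2 K.measure).toReal := by
  have : IsProbabilityMeasure (volume.restrict (Icc a (a + 1))) := ⟨by simp⟩
  have hle : volume.restrict (Icc a (a + 1)) ≤ K.measure := by
    rw [SpatialDomain.measure_eq_restrict_dom]
    exact Measure.restrict_mono ha le_rfl
  have hf' := hf.mono_measure hle
  have hi : IntegrableOn f (Icc a (a + 1)) := hf'.integrable one_le_two
  refine ⟨hi, ?_⟩
  have h1 : ∫ x in Icc a (a + 1), |f x|
      = (eLpNorm f 1 (volume.restrict (Icc a (a + 1)))).toReal := by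
    rw [eLpNorm_one_eq_lintegral_enorm]
    exact integral_norm_eq_lintegral_enorm hi.aestronglyMeasurable
  rw [h1]
  refine ENNReal.toReal_mono hf.2.ne ?_
  exact (eLpNorm_le_eLpNorm_of_exponent_le one_le_two hf'.1).trans (eLpNorm_mono_measure f hle)

/-- The Sobolev embedding `H¹(𝕂) ⊆ L^∞(𝕂)`. -/
theorem ae_abs_le (h : HasWeakDeriv K f g) :
    ∀ᵐ x ∂K.measure,
      |f x| ≤ (eLpNorm f 2 K.measure).toReal + (eLpNorm g 2 K.measure).toReal := by
  obtain ⟨F, hF, -, hFd⟩ := h.exists_primitive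
  have hFm : MemLp F 2 K.measure := (memLp_congr_ae hF).2 h.memLp
  rw [← eLpNorm_congr_ae hF]
  have key : ∀ x ∈ K.dom,
      |F x| ≤ (eLpNorm F 2 K.measure).toReal + (eLpNorm g 2 K.measure).toReal := by
    intro x hx
    obtain ⟨a, hxa, ha⟩ := SpatialDomain.exists_unit_interval hx
    obtain ⟨i1, b1⟩ := integral_abs_Icc_le hFm ha
    obtain ⟨i2, b2⟩ := integral_abs_Icc_le h.memLp_deriv ha
    have : IsProbabilityMeasure (volume.restrict (Icc a (a + 1))) := ⟨by simp⟩
    -- The oscillation of `F` on the unit interval is at most `∫ |g|`; averaging this inequality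
    -- over `y` gives the embedding.
    have h1 : ∀ y ∈ Icc a (a + 1), |F x| - ∫ z in Icc a (a + 1), |g z| ≤ |F y| := by
      intro y hy
      rw [hFd y (ha hy) x hx]
      have h2 : |∫ z in y..x, g z| ≤ ∫ z in Icc a (a + 1), |g z| := by
        refine (intervalIntegral.norm_integral_le_integral_norm_uIoc (μ := volume) (f := g)).trans ?_
        exact setIntegral_mono_set i2.norm (ae_of_all _ fun z => norm_nonneg _)
          (ae_of_all _ fun z hz => ordConnected_Icc.uIcc_subset hy hxa (uIoc_subset_uIcc hz))
      have := abs_add_le (F y) (∫ z in y..x, g z)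
      linarith
    have h3 : ∫ y in Icc a (a + 1), (|F x| - ∫ z in Icc a (a + 1), |g z|)
        ≤ ∫ y in Icc a (a + 1), |F y| :=
      setIntegral_mono_on (integrable_const _) i1.norm measurableSet_Icc h1
    rw [integral_const, probReal_univ, one_smul] at h3
    linarith
  have hd : ∀ᵐ x ∂K.measure, x ∈ K.dom := by
    rw [SpatialDomain.measure_eq_restrict_dom]
    exact ae_restrict_mem K.measurableSet_dom
  filter_upwards [hF, hd] with x h1 h2
  rw [← h1]
  exact key x h2

theorem memLp_top (h : HasWeakDeriv K f g) : MemLp f ⊤ K.measure :=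
  memLp_top_of_bound h.memLp.1 _ h.ae_abs_le

/-- The special case that yields the full product rule: it makes `g φ` an admissible partner of `f`
in integration by parts. -/
theorem mul_isTest {φ : ℝ → ℝ} (h : HasWeakDeriv K f f') (hφ : K.IsTest φ) :
    HasWeakDeriv K (fun x => f x * φ x) (fun x => f' x * φ x + f x * deriv φ x) := by
  have m : ∀ {u φ : ℝ → ℝ}, MemLp u 2 K.measure → K.IsTest φ →
      MemLp (fun x => u x * φ x) 2 K.measure := fun {u φ} hu hφ => by
    obtain ⟨C, hC⟩ := hφ.exists_bound
    have h1 : MemLp φ ⊤ K.measure := memLp_top_of_bound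
      hφ.contDiff.continuous.aestronglyMeasurable C (ae_of_all _ hC)
    exact h1.mul' (p := 2) (q := ⊤) (r := 2) hu
  refine ⟨m h.memLp hφ, (m h.memLp_deriv hφ).add (m h.memLp hφ.deriv), fun ψ hψ => ?_⟩
  have e := h.integral_eq _ (hφ.mul hψ)
  have hd : deriv (fun x => φ x * ψ x) = fun x => deriv φ x * ψ x + φ x * deriv ψ x :=
    funext fun x => deriv_fun_mul (hφ.differentiable x) (hψ.differentiable x)
  rw [hd] at e
  have e1 : ∀ x, f x * (deriv φ x * ψ x + φ x * deriv ψ x)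
      = f x * (deriv φ x * ψ x) + f x * φ x * deriv ψ x := fun x => by ring
  simp_rw [e1] at e
  rw [integral_add (integrable_mul_isTest h.memLp (hφ.deriv.mul hψ))
    (integrable_mul_isTest (m h.memLp hφ) hψ.deriv)] at e
  have e2 : ∀ x, (f' x * φ x + f x * deriv φ x) * ψ x
      = f' x * (φ x * ψ x) + f x * (deriv φ x * ψ x) := fun x => by ring
  simp_rw [e2]
  rw [integral_add (integrable_mul_isTest h.memLp_deriv (hφ.mul hψ))
    (integrable_mul_isTest h.memLp (hφ.deriv.mul hψ))]
  linarith

/-- The product rule in `H¹(𝕂)`. -/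
theorem mul (h : HasWeakDeriv K f f') (h' : HasWeakDeriv K g g') :
    HasWeakDeriv K (fun x => f x * g x) (fun x => f' x * g x + f x * g' x) := by
  have m1 : MemLp (fun x => f' x * g x) 2 K.measure :=
    h'.memLp_top.mul' (p := 2) (q := ⊤) (r := 2) h.memLp_deriv
  have m2 : MemLp (fun x => f x * g' x) 2 K.measure :=
    h'.memLp_deriv.mul' (p := ⊤) (q := 2) (r := 2) h.memLp_top
  have m3 : MemLp (fun x => f x * g x) 2 K.measure :=
    h'.memLp.mul' (p := ⊤) (q := 2) (r := 2) h.memLp_top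
  refine ⟨m3, m1.add m2, fun φ hφ => ?_⟩
  -- Integration by parts for the pair `f`, `g φ` is the defining identity of the weak derivative of
  -- `f g`.
  have e := h.integral_mul_add_mul (h'.mul_isTest hφ)
  have e1 : ∀ x, f x * (g' x * φ x + g x * deriv φ x)
      = f x * g' x * φ x + f x * g x * deriv φ x := fun x => by ring
  simp_rw [e1] at e
  rw [integral_add (integrable_mul_isTest m2 hφ) (integrable_mul_isTest m3 hφ.deriv)] at e
  simp_rw [add_mul]
  rw [integral_add (integrable_mul_isTest m1 hφ) (integrable_mul_isTest m2 hφ)]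
  simp_rw [← mul_assoc] at e
  linarith

end HasWeakDeriv

/-! ### Cauchy–Schwarz and Hölder bounds -/

namespace MeasureTheory

/-- The `L²` norm of a function, as a real number. -/
noncomputable def l2norm (K : SpatialDomain) (f : ℝ → ℝ) : ℝ := (eLpNorm f 2 K.measure).toReal

variable {K : SpatialDomain} {f g h : ℝ → ℝ}

theorem l2norm_nonneg : 0 ≤ l2norm K f := ENNReal.toReal_nonneg

theorem abs_integral_mul_le (hf : MemLp f 2 K.measure) (hg : MemLp g 2 K.measure) :
    |∫ x, f x * g x ∂K.measure| ≤ l2norm K f * l2norm K g := by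
  have h1 := abs_real_inner_le_norm (hf.toLp f) (hg.toLp g)
  rw [Lp.norm_toLp, Lp.norm_toLp, L2.inner_def] at h1
  refine (le_of_eq ?_).trans h1
  congr 1
  refine integral_congr_ae ?_
  filter_upwards [hf.coeFn_toLp, hg.coeFn_toLp] with x h2 h3
  simp [h2, h3, mul_comm]

theorem abs_integral_mul_mul_le {M : ℝ} (hM : ∀ᵐ x ∂K.measure, |f x| ≤ M)
    (hf : AEStronglyMeasurable f K.measure) (hM0 : 0 ≤ M)
    (hg : MemLp g 2 K.measure) (hh : MemLp h 2 K.measure) :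
    |∫ x, f x * g x * h x ∂K.measure| ≤ M * l2norm K g * l2norm K h := by
  have hle : ∀ᵐ x ∂K.measure, ‖f x * g x‖ ≤ M * ‖g x‖ := by
    filter_upwards [hM] with x hx
    rw [norm_mul]
    exact mul_le_mul_of_nonneg_right hx (norm_nonneg _)
  have hm : MemLp (fun x => f x * g x) 2 K.measure := hg.of_le_mul (hf.mul hg.1) hle
  refine (abs_integral_mul_le hm hh).trans (mul_le_mul_of_nonneg_right ?_ l2norm_nonneg)
  have h1 := eLpNorm_le_mul_eLpNorm_of_ae_le_mul hle 2
  have h2 := ENNReal.toReal_mono (ENNReal.mul_ne_top ENNReal.ofReal_ne_top hg.2.ne) h1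
  rwa [ENNReal.toReal_mul, ENNReal.toReal_ofReal hM0] at h2

end MeasureTheory

/-! ### Cubic integrals and the energy estimate -/

/-- The Leibniz expression for the `k`-th derivative of `f²`, in terms of the sequence of
derivatives of `f`. -/
def leibnizSq (f : ℕ → ℝ → ℝ) (k : ℕ) (x : ℝ) : ℝ :=
  ∑ p ∈ Finset.HasAntidiagonal.antidiagonal k, (k.choose p.1 : ℝ) * (f p.1 x * f p.2 x)

section Estimates

variable {K : SpatialDomain} {f v : ℕ → ℝ → ℝ} {n : ℕ}

/-- The product rule termwise, regrouped by Pascal's rule. -/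
theorem HasWeakDeriv.leibnizSq {k : ℕ} (hf : ∀ i ≤ k, HasWeakDeriv K (f i) (f (i + 1))) :
    HasWeakDeriv K (leibnizSq f k) (leibnizSq f (k + 1)) := by
  have h1 := HasWeakDeriv.sum (K := K) (Finset.HasAntidiagonal.antidiagonal k)
    (f := fun p x => (k.choose p.1 : ℝ) * (f p.1 x * f p.2 x))
    (f' := fun p x => (k.choose p.1 : ℝ) * (f (p.1 + 1) x * f p.2 x + f p.1 x * f (p.2 + 1) x))
    fun p hp => by
      have := Finset.HasAntidiagonal.mem_antidiagonal.1 hp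
      exact ((hf p.1 (by omega)).mul (hf p.2 (by omega))).const_mul _
  refine h1.congr (ae_eq_refl _) (ae_of_all _ fun x => ?_)
  simp only [_root_.leibnizSq]
  rw [Finset.sum_antidiagonal_choose_succ_mul (fun a b => f a x * f b x), ← Finset.sum_add_distrib]
  refine Finset.sum_congr rfl fun p hp => ?_
  rw [← Nat.choose_symm_of_eq_add (Finset.HasAntidiagonal.mem_antidiagonal.1 hp).symm]
  ring

/-- The equation, differentiated `j` times. -/
theorem sub_eq_leibnizSq (hf : ∀ i ≤ n + 1, HasWeakDeriv K (f i) (f (i + 1)))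
    (hv : ∀ i ≤ n, HasWeakDeriv K (v i) (v (i + 1)))
    (heq : (fun x => v 0 x - v 2 x) =ᵐ[K.measure]
      fun x => 2 * leibnizSq f 1 x + leibnizSq f 2 x - leibnizSq f 3 x) (j : ℕ) (hj : j + 1 ≤ n) :
    (fun x => v j x - v (j + 2) x) =ᵐ[K.measure]
      fun x => 2 * leibnizSq f (j + 1) x + leibnizSq f (j + 2) x - leibnizSq f (j + 3) x := by
  have hQ : ∀ k ≤ n + 1, HasWeakDeriv K (leibnizSq f k) (leibnizSq f (k + 1)) := fun k hk =>
    HasWeakDeriv.leibnizSq fun i hi => hf i (hi.trans hk)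
  induction j with
  | zero => simpa using heq
  | succ j ih =>
    have h1 := (hv j (by omega)).sub (hv (j + 2) (by omega))
    have h2 := (((hQ (j + 1) (by omega)).const_mul 2).add (hQ (j + 2) (by omega))).sub
      (hQ (j + 3) (by omega))
    -- Functions equal almost everywhere have equal weak derivatives, so the identity may be
    -- differentiated.
    exact h1.unique h2 (ih (by omega))

/-- The bound must be quadratic in the top norm `X` for Grönwall to apply linearly to `X²`, so one
of the three factors has to be absorbed by `κ` or by the lower-order bound `B`. -/
theorem abs_integral_triple_le {N : ℕ} {κ B X : ℝ} (hN : N ≤ n)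
    (hf : ∀ i ≤ n + 1, HasWeakDeriv K (f i) (f (i + 1)))
    (hκ : 0 ≤ κ) (h0 : ∀ᵐ x ∂K.measure, |f 0 x| ≤ κ) (h1 : ∀ᵐ x ∂K.measure, |f 1 x| ≤ κ)
    (hB0 : 0 ≤ B) (hB : ∀ i, 2 ≤ i → i + 1 ≤ N → l2norm K (f i) ≤ B)
    (hX : ∀ i ≤ N, l2norm K (f i) ≤ X) {a b c : ℕ} (hab : a + b ≤ N + 1) (ha : a ≤ N) (hb : b ≤ N)
    (hc : c ≤ N) :
    |∫ x, f a x * f b x * f c x ∂K.measure| ≤ (κ + 2 * B) * X ^ 2 := by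
  have hX0 : 0 ≤ X := l2norm_nonneg.trans (hX 0 (Nat.zero_le _))
  have hm : ∀ i ≤ N, MemLp (f i) 2 K.measure := fun i hi => (hf i (by omega)).memLp
  have small : ∀ a b : ℕ, a ≤ 1 → a ≤ N → b ≤ N →
      |∫ x, f a x * f b x * f c x ∂K.measure| ≤ (κ + 2 * B) * X ^ 2 := by
    intro a b ha ha' hb
    have hk : ∀ᵐ x ∂K.measure, |f a x| ≤ κ := by
      interval_cases a <;> assumption
    refine (abs_integral_mul_mul_le hk (hm a ha').1 hκ (hm b hb) (hm c hc)).trans ?_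
    calc κ * l2norm K (f b) * l2norm K (f c) ≤ κ * X * X := by
          gcongr
          · exact l2norm_nonneg
          · exact hX b hb
          · exact hX c hc
      _ ≤ (κ + 2 * B) * X ^ 2 := by nlinarith [mul_nonneg hB0 (sq_nonneg X)]
  rcases Nat.lt_or_ge 1 a with h2 | h2
  swap
  · exact small a b h2 ha hb
  rcases Nat.lt_or_ge 1 b with h3 | h3
  swap
  · have := small b a h3 hb ha
    simpa only [mul_comm (f b _) (f a _)] using this
  -- Here `a, b ≥ 2`, so `a + b ≤ N + 1` forces both to be at most `N - 1`: the embedding for `f a`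
  -- uses orders up to `N` only, and `f b` is within reach of `B`.
  have hk : ∀ᵐ x ∂K.measure, |f a x| ≤ 2 * X := by
    filter_upwards [(hf a (by omega)).ae_abs_le] with x hx
    have e1 := hX a ha
    have e2 := hX (a + 1) (by omega)
    unfold l2norm at e1 e2
    linarith
  refine (abs_integral_mul_mul_le hk (hm a ha).1 (by positivity) (hm b hb) (hm c hc)).trans ?_
  calc 2 * X * l2norm K (f b) * l2norm K (f c) ≤ 2 * X * B * X := by
        gcongr
        · exact l2norm_nonneg
        · exact hB b h3 (by omega)
        · exact hX c hc
    _ ≤ (κ + 2 * B) * X ^ 2 := by nlinarith [mul_nonneg hκ (sq_nonneg X)]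

/-- The factor of order `N + 1` is removed by `2 ∫ f 0 * f (N+1) * f N = -∫ f 1 * (f N)²`. -/
theorem abs_integral_triple_top_le {N : ℕ} {κ X : ℝ} (hN : N ≤ n)
    (hf : ∀ i ≤ n + 1, HasWeakDeriv K (f i) (f (i + 1)))
    (hκ : 0 ≤ κ) (h1 : ∀ᵐ x ∂K.measure, |f 1 x| ≤ κ)
    (hX : l2norm K (f N) ≤ X) :
    |∫ x, f 0 x * f (N + 1) x * f N x ∂K.measure| ≤ κ * X ^ 2 := by
  have hX0 : 0 ≤ X := l2norm_nonneg.trans hX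
  have hm := (hf N (by omega)).memLp
  have e := ((hf 0 (by omega)).mul (hf N (by omega))).integral_mul_add_mul (hf N (by omega))
  have m1 : MemLp (fun x => f 1 x * f N x) 2 K.measure :=
    ((hf 1 (by omega)).mul (hf N (by omega))).memLp
  have m2 : MemLp (fun x => f 0 x * f (N + 1) x) 2 K.measure :=
    ((hf 0 (by omega)).mul (hf (N + 1) (by omega))).memLp
  simp_rw [add_mul, zero_add] at e
  have hsw : ∀ x, f 0 x * f N x * f (N + 1) x = f 0 x * f (N + 1) x * f N x := fun x => by ring
  simp_rw [hsw] at e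
  have e2 := integral_add (m1.integrable_mul hm) (m2.integrable_mul hm)
  simp only [Pi.mul_apply] at e2
  rw [e2] at e
  have h2 := abs_integral_mul_mul_le h1 (hf 1 (by omega)).memLp.1 hκ hm hm
  have h3 : κ * l2norm K (f N) * l2norm K (f N) ≤ κ * X * X := by
    gcongr
    exact l2norm_nonneg
  rw [abs_le] at h2 ⊢
  constructor <;> nlinarith [mul_nonneg hκ (sq_nonneg X)]

/-- The factor `2 ^ k` is the sum of the binomial coefficients. -/
theorem abs_integral_leibnizSq_mul_le {k c : ℕ} {A : ℝ}
    (hf : ∀ i ≤ k, HasWeakDeriv K (f i) (f (i + 1))) (hc : MemLp (f c) 2 K.measure)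
    (hA : ∀ a b, a + b = k → |∫ x, f a x * f b x * f c x ∂K.measure| ≤ A) :
    |∫ x, leibnizSq f k x * f c x ∂K.measure| ≤ 2 ^ k * A := by
  have hi : ∀ p ∈ Finset.HasAntidiagonal.antidiagonal k,
      Integrable (fun x => (k.choose p.1 : ℝ) * (f p.1 x * f p.2 x * f c x)) K.measure := by
    intro p hp
    have := Finset.HasAntidiagonal.mem_antidiagonal.1 hp
    have hm := ((hf p.1 (by omega)).mul (hf p.2 (by omega))).memLp
    exact (hm.integrable_mul hc).const_mul _
  simp_rw [leibnizSq, Finset.sum_mul, mul_assoc ((k.choose _ : ℕ) : ℝ)]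
  rw [integral_finsetSum _ hi]
  refine (Finset.abs_sum_le_sum_abs _ _).trans ?_
  calc ∑ p ∈ Finset.HasAntidiagonal.antidiagonal k,
        |∫ x, (k.choose p.1 : ℝ) * (f p.1 x * f p.2 x * f c x) ∂K.measure|
      ≤ ∑ p ∈ Finset.HasAntidiagonal.antidiagonal k, (k.choose p.1 : ℝ) * A := by
        refine Finset.sum_le_sum fun p hp => ?_
        rw [integral_const_mul, abs_mul, Nat.abs_cast]
        exact mul_le_mul_of_nonneg_left (hA _ _ (Finset.HasAntidiagonal.mem_antidiagonal.1 hp)) (Nat.cast_nonneg _)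
    _ = 2 ^ k * A := by
        rw [← Finset.sum_mul, Finset.Nat.sum_antidiagonal_eq_sum_range_succ_mk]
        congr 1
        exact_mod_cast Nat.sum_range_choose k

/-- The energy estimate at a fixed time. -/
theorem energy_estimate (hf : ∀ i ≤ n + 1, HasWeakDeriv K (f i) (f (i + 1)))
    (hv : ∀ i ≤ n, HasWeakDeriv K (v i) (v (i + 1)))
    (heq : (fun x => v 0 x - v 2 x) =ᵐ[K.measure]
      fun x => 2 * leibnizSq f 1 x + leibnizSq f 2 x - leibnizSq f 3 x)
    {j : ℕ} (hj : j + 1 ≤ n) {κ B X : ℝ}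
    (hκ : 0 ≤ κ) (h0 : ∀ᵐ x ∂K.measure, |f 0 x| ≤ κ) (h1 : ∀ᵐ x ∂K.measure, |f 1 x| ≤ κ)
    (hB0 : 0 ≤ B) (hB : ∀ i, 2 ≤ i → i ≤ j → l2norm K (f i) ≤ B)
    (hX : ∀ i ≤ j + 1, l2norm K (f i) ≤ X) :
    ∫ x, f j x * v j x ∂K.measure + ∫ x, f (j + 1) x * v (j + 1) x ∂K.measure
      ≤ 5 * 2 ^ (j + 1) * ((κ + 2 * B) * X ^ 2) := by
  have hB' : ∀ i, 2 ≤ i → i + 1 ≤ j + 1 → l2norm K (f i) ≤ B := fun i h2 hi =>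
    hB i h2 (by omega)
  have hQ : ∀ k ≤ n + 1, HasWeakDeriv K (leibnizSq f k) (leibnizSq f (k + 1)) := fun k hk =>
    HasWeakDeriv.leibnizSq fun i hi => hf i (hi.trans hk)
  have tri : ∀ a b c : ℕ, a + b ≤ j + 2 → a ≤ j + 1 → b ≤ j + 1 → c ≤ j + 1 →
      |∫ x, f a x * f b x * f c x ∂K.measure| ≤ (κ + 2 * B) * X ^ 2 := fun a b c h2 h3 h4 h5 =>
    abs_integral_triple_le hj hf hκ h0 h1 hB0 hB' hX h2 h3 h4 h5
  have top : |∫ x, f 0 x * f (j + 1 + 1) x * f (j + 1) x ∂K.measure| ≤ (κ + 2 * B) * X ^ 2 :=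
    (abs_integral_triple_top_le hj hf hκ h1 (hX _ le_rfl)).trans
      (mul_le_mul_of_nonneg_right (by linarith) (sq_nonneg X))
  have mj := (hf j (by omega)).memLp
  have mN := (hf (j + 1) (by omega)).memLp
  have b1 : |∫ x, leibnizSq f (j + 1) x * f j x ∂K.measure|
      ≤ 2 ^ (j + 1) * ((κ + 2 * B) * X ^ 2) :=
    abs_integral_leibnizSq_mul_le (fun i hi => hf i (by omega)) mj fun a b hab =>
      tri a b j (by omega) (by omega) (by omega) (by omega)
  have b2 : |∫ x, leibnizSq f (j + 1) x * f (j + 1) x ∂K.measure|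
      ≤ 2 ^ (j + 1) * ((κ + 2 * B) * X ^ 2) :=
    abs_integral_leibnizSq_mul_le (fun i hi => hf i (by omega)) mN fun a b hab =>
      tri a b (j + 1) (by omega) (by omega) (by omega) (by omega)
  have b3 : |∫ x, leibnizSq f (j + 2) x * f (j + 1) x ∂K.measure|
      ≤ 2 ^ (j + 2) * ((κ + 2 * B) * X ^ 2) := by
    -- The two extreme Leibniz terms carry a derivative of order `j + 2` and need the extra
    -- integration by parts; all others have orders at most `j + 1`.
    refine abs_integral_leibnizSq_mul_le (fun i hi => hf i (by omega)) mN fun a b hab => ?_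
    rcases Nat.eq_zero_or_pos a with ha | ha
    · obtain rfl : b = j + 1 + 1 := by omega
      subst ha
      exact top
    rcases Nat.eq_zero_or_pos b with hb | hb
    · obtain rfl : a = j + 1 + 1 := by omega
      subst hb
      simpa only [mul_comm (f (j + 1 + 1) _) (f 0 _)] using top
    exact tri a b (j + 1) (by omega) (by omega) (by omega) le_rfl
  -- One derivative is moved onto `f j` in each of the terms with `Q (j+2)`, `Q (j+3)` and `v
  -- (j+2)`.
  have p1 := (hQ (j + 1) (by omega)).integral_mul_add_mul (hf j (by omega))
  have p2 := (hQ (j + 2) (by omega)).integral_mul_add_mul (hf j (by omega))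
  have p3 := (hv (j + 1) hj).integral_mul_add_mul (hf j (by omega))
  have e := sub_eq_leibnizSq hf hv heq j hj
  have e' : ∫ x, (v j x - v (j + 2) x) * f j x ∂K.measure
      = ∫ x, (2 * leibnizSq f (j + 1) x + leibnizSq f (j + 2) x - leibnizSq f (j + 3) x) * f j x
        ∂K.measure := integral_congr_ae (e.mono fun x hx => by simp only at hx ⊢; rw [hx])
  have i1 := (hQ (j + 1) (by omega)).memLp.integrable_mul mj
  have i2 := (hQ (j + 2) (by omega)).memLp.integrable_mul mj
  have i3 := (hQ (j + 2) (by omega)).memLp_deriv.integrable_mul mj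
  have i4 := (hv j (by omega)).memLp.integrable_mul mj
  have i5 := (hv (j + 1) (by omega)).memLp_deriv.integrable_mul mj
  have l1 : ∫ x, (v j x - v (j + 2) x) * f j x ∂K.measure
      = ∫ x, v j x * f j x ∂K.measure - ∫ x, v (j + 2) x * f j x ∂K.measure := by
    simp_rw [sub_mul]
    exact integral_sub i4 i5
  have l2 : ∫ x, (2 * leibnizSq f (j + 1) x + leibnizSq f (j + 2) x - leibnizSq f (j + 3) x) * f j x
        ∂K.measure = 2 * ∫ x, leibnizSq f (j + 1) x * f j x ∂K.measure
        + ∫ x, leibnizSq f (j + 2) x * f j x ∂K.measure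
        - ∫ x, leibnizSq f (j + 3) x * f j x ∂K.measure := by
    simp_rw [sub_mul, add_mul, mul_assoc]
    rw [← integral_const_mul]
    exact (integral_sub ((i1.const_mul 2).add i2) i3).trans
      (congrArg (· - _) (integral_add (i1.const_mul 2) i2))
  rw [l1, l2] at e'
  simp_rw [mul_comm (f _ _) (v _ _)]
  have hp : (2 : ℝ) ^ (j + 2) = 2 * 2 ^ (j + 1) := by ring
  rw [hp] at b3
  rw [abs_le] at b1 b2 b3
  simp only [show j + 1 + 1 = j + 2 from rfl, show j + 2 + 1 = j + 3 from rfl] at *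
  -- In units of `2 ^ (j + 1)` the three integrals contribute `2 + 1 + 2 = 5`.
  linarith [b1.2, b2.1, b3.2]

end Estimates

/-! ### Grönwall's inequality -/

/-- Grönwall's inequality with a coefficient that is integrable up to the end of the interval. -/
theorem exists_forall_le_of_deriv_le_mul {z z' a : ℝ → ℝ} {t : ℝ}
    (hz : ContinuousOn z (Ico 0 t)) (hz' : ∀ s ∈ Ioo 0 t, HasDerivAt z (z' s) s)
    (hle : ∀ s ∈ Ioo 0 t, z' s ≤ a s * z s) (ha : ContinuousOn a (Ico 0 t))
    (ha0 : ∀ s, 0 ≤ a s) (hint : ∫⁻ s in Ioo 0 t, ENNReal.ofReal (a s) < ⊤)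
    (hz0 : ∀ s ∈ Ico 0 t, 0 ≤ z s) : ∃ M, ∀ s ∈ Ico 0 t, z s ≤ M := by
  have hai : IntegrableOn a (Ioo 0 t) := by
    refine ⟨(ha.mono Ioo_subset_Ico_self).aestronglyMeasurable measurableSet_Ioo, ?_⟩
    rwa [hasFiniteIntegral_iff_ofReal (ae_of_all _ ha0)]
  -- The coefficient may blow up at `t`; extended by zero it is integrable on `ℝ`, so its primitive
  -- `A` is continuous and bounded by the total integral.
  set a₀ := (Ioo 0 t).indicator a with ha₀
  have hi : Integrable a₀ := hai.integrable_indicator measurableSet_Ioo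
  have ha₀0 : ∀ s, 0 ≤ a₀ s := fun s => indicator_nonneg (fun s _ => ha0 s) s
  set A : ℝ → ℝ := fun s => ∫ r in (0 : ℝ)..s, a₀ r with hA
  have hAc : Continuous A := intervalIntegral.continuous_primitive
    (fun _ _ => hi.intervalIntegrable) 0
  have hAd : ∀ s ∈ Ioo 0 t, HasDerivAt A (a s) s := by
    intro s hs
    have e : a₀ =ᶠ[𝓝 s] a := by
      filter_upwards [isOpen_Ioo.mem_nhds hs] with r hr
      exact indicator_of_mem hr a
    have hc : ContinuousAt a s :=
      (ha.mono Ioo_subset_Ico_self).continuousAt (isOpen_Ioo.mem_nhds hs)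
    have := intervalIntegral.integral_hasDerivAt_right (a := 0) (b := s) hi.intervalIntegrable
      (hi.aestronglyMeasurable.stronglyMeasurableAtFilter) (hc.congr e.symm)
    rwa [show a₀ s = a s from indicator_of_mem hs a] at this
  have hAle : ∀ s, 0 ≤ s → A s ≤ ∫ r, a₀ r := fun s hs => by
    simp only [hA]
    rw [intervalIntegral.integral_of_le hs]
    exact setIntegral_le_integral hi (ae_of_all _ ha₀0)
  have hgd : ∀ s ∈ Ioo 0 t, HasDerivAt (fun s => z s * Real.exp (-A s))
      (z' s * Real.exp (-A s) + z s * (Real.exp (-A s) * -a s)) s := fun s hs =>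
    (hz' s hs).mul (hAd s hs).neg.exp
  -- The integrating factor turns the differential inequality into monotonicity.
  have hanti : AntitoneOn (fun s => z s * Real.exp (-A s)) (Ico 0 t) := by
    refine antitoneOn_of_deriv_nonpos (convex_Ico 0 t)
      (hz.mul (Real.continuous_exp.comp hAc.neg).continuousOn) ?_ ?_
    · rw [interior_Ico]
      exact fun s hs => (hgd s hs).differentiableAt.differentiableWithinAt
    · rw [interior_Ico]
      intro s hs
      rw [(hgd s hs).deriv]
      have h1 := hle s hs
      have h2 := Real.exp_pos (-A s)
      nlinarith
  refine ⟨z 0 * Real.exp (∫ r, a₀ r), fun s hs => ?_⟩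
  have h0 : (0 : ℝ) ∈ Ico 0 t := ⟨le_rfl, hs.1.trans_lt hs.2⟩
  have h1 := hanti h0 hs hs.1
  simp only [hA, intervalIntegral.integral_same, neg_zero, Real.exp_zero, mul_one] at h1
  have h2 : z s = z s * Real.exp (-A s) * Real.exp (A s) := by
    rw [mul_assoc, ← Real.exp_add]; simp
  rw [h2]
  exact mul_le_mul h1 (Real.exp_le_exp.2 (hAle s hs.1)) (Real.exp_pos _).le (hz0 0 h0)

/-! ### Derivatives and sup norms of Sobolev functions -/

namespace Sobolev

variable {K : SpatialDomain} {s : ℕ}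

/-- The `j`-th derivative as a continuous linear map `H^s(𝕂) → L²(𝕂)`; it is `0` for `j > s`. -/
noncomputable def jet (K : SpatialDomain) (s j : ℕ) : Sobolev K s →L[ℝ] L2 K :=
  if h : j < s + 1 then
    (PiLp.proj 2 (fun _ : Fin (s + 1) => L2 K) ⟨j, h⟩).comp (sobolevSubmodule K s).subtypeL
  else 0

theorem jet_apply {j : ℕ} (h : j < s + 1) (F : Sobolev K s) : jet K s j F = F.dx ⟨j, h⟩ := by
  rw [jet, dif_pos h]
  rfl

theorem jet_incl {r s j : ℕ} (h : r ≤ s) (hj : j ≤ r) (F : Sobolev K s) :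
    jet K r j (incl h F) = jet K s j F := by
  rw [jet_apply (by omega), jet_apply (by omega)]
  rfl

theorem norm_jet_le {j : ℕ} (F : Sobolev K s) : ‖jet K s j F‖ ≤ ‖F‖ := by
  by_cases h : j < s + 1
  · rw [jet_apply h]
    exact PiLp.norm_apply_le (p := 2) F.1 ⟨j, h⟩
  · rw [jet, dif_neg h]
    simp

/-- Testing order `j` against `φ'` and order `j + 1` against `φ` gives the same left side; the sign
`(-1) ^ j` cancels. -/
theorem hasWeakDeriv_jet {j : ℕ} (h : j + 1 ≤ s) (F : Sobolev K s) :
    HasWeakDeriv K (jet K s j F) (jet K s (j + 1) F) := by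
  rw [jet_apply (by omega), jet_apply (by omega)]
  refine ⟨Lp.memLp _, Lp.memLp _, fun φ hφ => ?_⟩
  have h1 := F.2 ⟨j, by omega⟩ _ hφ.deriv
  have h2 := F.2 ⟨j + 1, by omega⟩ φ hφ
  simp only [← iteratedDeriv_succ'] at h1
  simp only at h2
  rw [h1, pow_succ, mul_assoc] at h2
  simpa [dx] using mul_left_cancel₀ (pow_ne_zero j (by norm_num : (-1 : ℝ) ≠ 0)) h2

theorem l2norm_jet {j : ℕ} (F : Sobolev K s) : l2norm K (jet K s j F) = ‖jet K s j F‖ :=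
  (Lp.norm_def _).symm

theorem integral_sq_eq (f : L2 K) : ∫ x, f x ^ 2 ∂K.measure = ‖f‖ ^ 2 := by
  rw [← real_inner_self_eq_norm_sq, L2.inner_def]
  refine integral_congr_ae (ae_of_all _ fun x => ?_)
  simp [sq]

theorem norm_sq_eq_sum (F : Sobolev K s) : ‖F‖ ^ 2 = ∑ j : Fin (s + 1), ‖F.dx j‖ ^ 2 :=
  PiLp.norm_sq_eq_of_L2 _ F.1

theorem norm_sq_eq_two_mul_energy (F : Sobolev K s) : ‖F‖ ^ 2 = 2 * F.energy := by
  rw [energy, integral_const_mul, integral_finsetSum _ fun j _ => (Lp.memLp _).integrable_sq,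
    norm_sq_eq_sum]
  simp_rw [integral_sq_eq]
  ring

/-- The `L^∞` norm of the `j`-th derivative, as a real number. -/
noncomputable def supNorm (j : ℕ) (F : Sobolev K s) : ℝ :=
  (eLpNorm (jet K s j F) ⊤ K.measure).toReal

theorem supNorm_nonneg (j : ℕ) (F : Sobolev K s) : 0 ≤ supNorm j F := ENNReal.toReal_nonneg

theorem memLp_top_jet {j : ℕ} (h : j + 1 ≤ s) (F : Sobolev K s) :
    MemLp (jet K s j F) ⊤ K.measure :=
  (hasWeakDeriv_jet h F).memLp_top

theorem ae_abs_jet_le_supNorm {j : ℕ} (h : j + 1 ≤ s) (F : Sobolev K s) :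
    ∀ᵐ x ∂K.measure, |jet K s j F x| ≤ supNorm j F := by
  have hm := memLp_top_jet h F
  have h1 := ae_le_eLpNormEssSup (f := jet K s j F) (μ := K.measure)
  filter_upwards [h1] with x hx
  rw [← eLpNorm_exponent_top] at hx
  have := ENNReal.toReal_mono hm.2.ne hx
  simpa [supNorm] using this

theorem supNorm_le_two_mul_norm {j : ℕ} (h : j + 1 ≤ s) (F : Sobolev K s) :
    supNorm j F ≤ 2 * ‖F‖ := by
  have hm := hasWeakDeriv_jet h F
  have h1 : eLpNorm (jet K s j F) ⊤ K.measure ≤ ENNReal.ofReal (2 * ‖F‖) := by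
    rw [eLpNorm_exponent_top]
    refine eLpNormEssSup_le_of_ae_bound ?_
    filter_upwards [hm.ae_abs_le] with x hx
    have e1 := norm_jet_le (j := j) F
    have e2 := norm_jet_le (j := j + 1) F
    rw [← l2norm_jet] at e1 e2
    unfold l2norm at e1 e2
    rw [Real.norm_eq_abs]
    linarith
  exact ENNReal.toReal_le_of_le_ofReal (by positivity) h1

theorem supNorm_le_add {j : ℕ} (h : j + 1 ≤ s) (F G : Sobolev K s) :
    supNorm j F ≤ supNorm j G + 2 * ‖F - G‖ := by
  have h1 : eLpNorm (jet K s j F) ⊤ K.measure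
      ≤ eLpNorm (jet K s j G) ⊤ K.measure + eLpNorm (jet K s j (F - G)) ⊤ K.measure := by
    have e : (jet K s j F : ℝ → ℝ) =ᵐ[K.measure]
        (jet K s j G : ℝ → ℝ) + (jet K s j (F - G) : ℝ → ℝ) := by
      have := Lp.coeFn_add (jet K s j G) (jet K s j (F - G))
      rwa [← map_add, add_sub_cancel] at this
    rw [eLpNorm_congr_ae e]
    exact eLpNorm_add_le (Lp.memLp _).1 (Lp.memLp _).1 le_top
  have h2 := ENNReal.toReal_mono
    (ENNReal.add_ne_top.2 ⟨(memLp_top_jet h G).2.ne, (memLp_top_jet h (F - G)).2.ne⟩) h1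
  rw [ENNReal.toReal_add (memLp_top_jet h G).2.ne (memLp_top_jet h (F - G)).2.ne] at h2
  have h3 := supNorm_le_two_mul_norm h (F - G)
  unfold supNorm at *
  linarith

/-- By the embedding the sup norm is Lipschitz on `H^s`; along the solution this makes the Grönwall
coefficient continuous in time. -/
theorem continuous_supNorm {j : ℕ} (h : j + 1 ≤ s) :
    Continuous (supNorm j : Sobolev K s → ℝ) := by
  refine (LipschitzWith.of_le_add_mul 2 fun F G => ?_).continuous
  rw [dist_eq_norm]
  exact supNorm_le_add h F G

theorem ofReal_supNorm_le_maxNorm {m j : ℕ} (hm : m ≤ s) (hj : j ≤ m) (F : Sobolev K s) :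
    ENNReal.ofReal (supNorm j F) ≤ (incl hm F).maxNorm := by
  refine ENNReal.ofReal_toReal_le.trans ?_
  rw [← jet_incl hm hj F, jet_apply (by omega)]
  exact le_iSup (fun i => eLpNorm ((incl hm F).dx i) ⊤ K.measure) ⟨j, by omega⟩

theorem hasDerivAt_norm_sq_jet {F : ℝ → Sobolev K s} {F' : Sobolev K s} {τ : ℝ}
    (h : HasDerivAt F F' τ) (i : ℕ) :
    HasDerivAt (fun τ => ‖jet K s i (F τ)‖ ^ 2)
      (2 * ∫ x, jet K s i (F τ) x * jet K s i F' x ∂K.measure) τ := by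
  have h1 : HasDerivAt (fun τ => jet K s i (F τ)) (jet K s i F') τ :=
    (jet K s i).hasFDerivAt.comp_hasDerivAt τ h
  have h2 := h1.norm_sq
  have e : inner ℝ (jet K s i (F τ)) (jet K s i F')
      = ∫ x, jet K s i (F τ) x * jet K s i F' x ∂K.measure := by
    rw [L2.inner_def]
    refine integral_congr_ae (ae_of_all _ fun x => ?_)
    simp [mul_comm]
  rwa [e] at h2

end Sobolev

/-! ### Energy bounds along the solution -/

open Sobolev

/-- Uniqueness of weak derivatives, applied three times, identifies the derivatives of `q = f²` with
the Leibniz expressions. -/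
theorem SpatialEquation.sub_eq_leibnizSq {K : SpatialDomain} {s r : ℕ} (hs : 3 ≤ s) (hr : 2 ≤ r)
    {f : Sobolev K s} {v : Sobolev K r} (h : SpatialEquation f (incl hr v)) :
    (fun x => jet K r 0 v x - jet K r 2 v x) =ᵐ[K.measure]
      fun x => 2 * leibnizSq (fun i => jet K s i f) 1 x + leibnizSq (fun i => jet K s i f) 2 x
        - leibnizSq (fun i => jet K s i f) 3 x := by
  obtain ⟨q, hq, he⟩ := h
  have hQ : ∀ k ≤ 2, HasWeakDeriv K (leibnizSq (fun i => jet K s i f) k)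
      (leibnizSq (fun i => jet K s i f) (k + 1)) := fun k hk =>
    HasWeakDeriv.leibnizSq fun i hi => hasWeakDeriv_jet (by omega) f
  have e0 : jet K 3 0 q =ᵐ[K.measure] leibnizSq (fun i => jet K s i f) 0 := by
    rw [jet_apply (by omega)]
    filter_upwards [hq] with x hx
    refine Eq.trans hx ?_
    simp only [leibnizSq, Finset.Nat.antidiagonal_zero, Finset.sum_singleton, Nat.choose_self,
      Nat.cast_one, one_mul, jet_apply (show 0 < s + 1 by omega)]
    exact sq _
  have e1 := (hasWeakDeriv_jet (j := 0) (by omega) q).unique (hQ 0 (by omega)) e0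
  have e2 := (hasWeakDeriv_jet (j := 1) (by omega) q).unique (hQ 1 (by omega)) e1
  have e3 := (hasWeakDeriv_jet (j := 2) (by omega) q).unique (hQ 2 (by omega)) e2
  have he' : jet K r 0 v - jet K r 2 v
      = (2 : ℝ) • jet K 3 1 q + jet K 3 2 q - jet K 3 3 q := by
    rw [← jet_incl hr (by omega) v, ← jet_incl hr (by omega) v, jet_apply (by omega),
      jet_apply (by omega), jet_apply (by omega), jet_apply (by omega), jet_apply (by omega)]
    exact he
  have h1 := Lp.coeFn_sub (jet K r 0 v) (jet K r 2 v)
  rw [he'] at h1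
  filter_upwards [h1, Lp.coeFn_sub ((2 : ℝ) • jet K 3 1 q + jet K 3 2 q) (jet K 3 3 q),
    Lp.coeFn_add ((2 : ℝ) • jet K 3 1 q) (jet K 3 2 q), Lp.coeFn_smul (2 : ℝ) (jet K 3 1 q),
    e1, e2, e3] with x a1 a2 a3 a4 a5 a6 a7
  simp only [Pi.sub_apply, Pi.add_apply, Pi.smul_apply, smul_eq_mul] at a1 a2 a3 a4
  rw [← a1, a2, a3, a4, a5, a6, a7]

theorem Ico_subset_timeInterval {T : EReal} {t : ℝ} (ht : (t : EReal) ≤ T) :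
    Ico 0 t ⊆ timeInterval T := fun _ hs =>
  ⟨hs.1, (EReal.coe_lt_coe_iff.2 hs.2).trans_le ht⟩

namespace IsSolution

variable {K : SpatialDomain} {n : ℕ} {hn : 1 ≤ n} {T : EReal} {u : ℝ → Sobolev K (n + 2)}

theorem hasDerivAt_norm_sq_jet (hu : IsSolution K n hn T u) {t τ : ℝ} (ht : (t : EReal) ≤ T)
    (hτ : τ ∈ Ioo 0 t) {i : ℕ} (hi : i ≤ n + 1) :
    HasDerivAt (fun τ => ‖jet K (n + 2) i (u τ)‖ ^ 2)
      (2 * ∫ x, jet K (n + 2) i (u τ) x * jet K (n + 1) i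
        (derivWithin (fun τ => incl (show n + 1 ≤ n + 2 by omega) (u τ)) (timeInterval T) τ) x
        ∂K.measure) τ := by
  -- At an interior time the one-sided derivative is a genuine derivative.
  have hs := Ico_subset_timeInterval ht
  have hmem : timeInterval T ∈ 𝓝 τ :=
    mem_of_superset (isOpen_Ioo.mem_nhds hτ) (Ioo_subset_Ico_self.trans hs)
  have h1 := ((hu.contDiffOn.differentiableOn one_ne_zero) τ
    (hs (Ioo_subset_Ico_self hτ))).hasDerivWithinAt.hasDerivAt hmem
  have h2 := Sobolev.hasDerivAt_norm_sq_jet h1 i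
  simp only [jet_incl _ hi] at h2
  exact h2

/-- One step of the bootstrap: bounds on the derivatives of order at most `j` yield bounds on the
derivatives of order at most `j + 1`. -/
theorem exists_bound_step (hu : IsSolution K n hn T u) {t : ℝ} (ht : (t : EReal) ≤ T)
    (hk : ∫⁻ τ in Ioo 0 t, (incl (show 1 ≤ n + 2 by omega) (u τ)).maxNorm < ⊤)
    {j : ℕ} (hj : j + 1 ≤ n) {B : ℝ} (hB0 : 0 ≤ B)
    -- The range of `i` is empty for `j = 0`, so the bootstrap starts with no prior bound.
    (hB : ∀ τ ∈ Ico 0 t, ∀ i, (2 ≤ i ∧ i ≤ j) ∨ i < j → ‖jet K (n + 2) i (u τ)‖ ≤ B) :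
    ∃ B', 0 ≤ B' ∧ ∀ τ ∈ Ico 0 t, ∀ i ≤ j + 1, ‖jet K (n + 2) i (u τ)‖ ≤ B' := by
  have hs := Ico_subset_timeInterval ht
  have huc : ContinuousOn u (Ico 0 t) := hu.continuousOn.mono hs
  set κ : ℝ → ℝ := fun τ => supNorm 0 (u τ) + supNorm 1 (u τ) with hκ
  have hκ0 : ∀ τ, 0 ≤ κ τ := fun τ => add_nonneg (supNorm_nonneg _ _) (supNorm_nonneg _ _)
  have hκc : ContinuousOn κ (Ico 0 t) :=
    ((continuous_supNorm (by omega)).comp_continuousOn huc).add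
      ((continuous_supNorm (by omega)).comp_continuousOn huc)
  -- The outer `2` comes from differentiating a squared norm.
  set C : ℝ := 2 * (5 * 2 ^ (j + 1)) with hC
  have hC0 : 0 ≤ C := by positivity
  -- Adding the constant `B ^ 2` lets `√z` dominate the norms of orders below `j` as well, without
  -- changing the derivative.
  set z : ℝ → ℝ := fun τ =>
    ‖jet K (n + 2) j (u τ)‖ ^ 2 + ‖jet K (n + 2) (j + 1) (u τ)‖ ^ 2 + B ^ 2 with hz
  have hz0 : ∀ τ, 0 ≤ z τ := fun τ => by positivity
  have hX : ∀ τ ∈ Ico 0 t, ∀ i ≤ j + 1, ‖jet K (n + 2) i (u τ)‖ ≤ √(z τ) := by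
    intro τ hτ i hi
    refine Real.le_sqrt_of_sq_le ?_
    simp only [hz]
    rcases Nat.lt_or_ge i j with h | h
    · have := pow_le_pow_left₀ (norm_nonneg _) (hB τ hτ i (Or.inr h)) 2
      linarith [sq_nonneg ‖jet K (n + 2) j (u τ)‖, sq_nonneg ‖jet K (n + 2) (j + 1) (u τ)‖]
    · obtain rfl | rfl : i = j ∨ i = j + 1 := by omega
      · linarith [sq_nonneg ‖jet K (n + 2) (i + 1) (u τ)‖, sq_nonneg B]
      · linarith [sq_nonneg ‖jet K (n + 2) j (u τ)‖, sq_nonneg B]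
  have hjc : ∀ i, ContinuousOn (fun τ => ‖jet K (n + 2) i (u τ)‖ ^ 2) (Ico 0 t) := fun i =>
    (((jet K (n + 2) i).continuous.comp_continuousOn huc).norm).pow 2
  obtain ⟨M, hM⟩ := exists_forall_le_of_deriv_le_mul (z := z) (t := t)
    (a := fun τ => C * (κ τ + 2 * B))
    (((hjc j).add (hjc (j + 1))).add continuousOn_const)
    (fun τ hτ => ((hu.hasDerivAt_norm_sq_jet ht hτ (i := j) (by omega)).add
      (hu.hasDerivAt_norm_sq_jet ht hτ (i := j + 1) (by omega))).add_const _)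
    (fun τ hτ => by
      have hτ' := Ioo_subset_Ico_self hτ
      have h1 := energy_estimate (K := K) (n := n) (f := fun i => jet K (n + 2) i (u τ))
        (v := fun i => jet K (n + 1) i
          (derivWithin (fun τ => incl (show n + 1 ≤ n + 2 by omega) (u τ)) (timeInterval T) τ))
        (fun i hi => hasWeakDeriv_jet (by omega) _) (fun i hi => hasWeakDeriv_jet (by omega) _)
        ((hu.equation τ (hs hτ')).sub_eq_leibnizSq (by omega) (by omega)) hj (hκ0 τ)
        ((ae_abs_jet_le_supNorm (by omega) (u τ)).mono fun x hx =>
          hx.trans (le_add_of_nonneg_right (supNorm_nonneg _ _)))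
        ((ae_abs_jet_le_supNorm (by omega) (u τ)).mono fun x hx =>
          hx.trans (le_add_of_nonneg_left (supNorm_nonneg _ _)))
        hB0 (fun i h2 hi => by rw [l2norm_jet]; exact hB τ hτ' i (Or.inl ⟨h2, hi⟩))
        (fun i hi => by rw [l2norm_jet]; exact hX τ hτ' i hi)
      rw [Real.sq_sqrt (hz0 τ)] at h1
      rw [← mul_add, hC]
      linarith)
    (continuousOn_const.mul (hκc.add continuousOn_const))
    (fun τ => mul_nonneg hC0 (add_nonneg (hκ0 τ) (by positivity)))
    (by
      -- `κ` is a sum of two sup norms, each at most `k_1`; the constant `B` is integrable because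
      -- `t` is finite.
      have h1 : ∀ τ, ENNReal.ofReal (C * (κ τ + 2 * B)) ≤ ENNReal.ofReal C *
          (2 * (incl (show 1 ≤ n + 2 by omega) (u τ)).maxNorm + ENNReal.ofReal (2 * B)) := by
        intro τ
        rw [ENNReal.ofReal_mul hC0, ENNReal.ofReal_add (hκ0 τ) (by positivity),
          ENNReal.ofReal_add (supNorm_nonneg _ _) (supNorm_nonneg _ _)]
        gcongr
        rw [two_mul]
        exact add_le_add (ofReal_supNorm_le_maxNorm _ zero_le_one (u τ))
          (ofReal_supNorm_le_maxNorm _ le_rfl (u τ))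
      refine (lintegral_mono h1).trans_lt ?_
      rw [lintegral_const_mul' _ _ ENNReal.ofReal_ne_top, lintegral_add_right _ measurable_const,
        lintegral_const_mul' _ _ (by simp), lintegral_const]
      refine ENNReal.mul_lt_top ENNReal.ofReal_lt_top (ENNReal.add_lt_top.2
        ⟨ENNReal.mul_lt_top (by simp) hk, ENNReal.mul_lt_top ENNReal.ofReal_lt_top ?_⟩)
      simp)
    (fun τ _ => hz0 τ)
  exact ⟨√M, Real.sqrt_nonneg _, fun τ hτ i hi =>
    (hX τ hτ i hi).trans (Real.sqrt_le_sqrt (hM τ hτ))⟩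

theorem exists_bound (hu : IsSolution K n hn T u) {t : ℝ} (ht : (t : EReal) ≤ T)
    (hk : ∫⁻ τ in Ioo 0 t, (incl (show 1 ≤ n + 2 by omega) (u τ)).maxNorm < ⊤)
    (j : ℕ) (hj : j + 1 ≤ n) :
    ∃ B, 0 ≤ B ∧ ∀ τ ∈ Ico 0 t, ∀ i ≤ j + 1, ‖jet K (n + 2) i (u τ)‖ ≤ B := by
  induction j with
  | zero => exact hu.exists_bound_step ht hk hj le_rfl fun τ _ i hi => by omega
  | succ j ih =>
    obtain ⟨B, hB0, hB⟩ := ih (by omega)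
    exact hu.exists_bound_step ht hk hj hB0 fun τ hτ i hi => hB τ hτ i (by omega)

end IsSolution

theorem Sobolev.maxNorm_incl_mono {K : SpatialDomain} {s m r : ℕ} (hrm : r ≤ m) (hm : m ≤ s)
    (F : Sobolev K s) : (incl (hrm.trans hm) F).maxNorm ≤ (incl hm F).maxNorm :=
  iSup_le fun j => le_iSup (fun i => eLpNorm ((incl hm F).dx i) ⊤ K.measure)
    (Fin.castLE (by omega) j)

theorem theorem2p1 (K : SpatialDomain) (n : ℕ) (hn : 1 ≤ n) (T : EReal) (hT : 0 < T)
    (u : ℝ → Sobolev K (n + 2)) (hu : IsSolution K n hn T u)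
    (m : ℕ) (hm : 1 ≤ m) (hmn : m ≤ n)
    (hk : ∀ t : ℝ, 0 ≤ t → (t : EReal) ≤ T →
      ∫⁻ τ in Ioo 0 t, (Sobolev.incl (show m ≤ n + 2 by omega) (u τ)).maxNorm < ⊤) :
    ∀ (N : ℕ) (hN : N ≤ n),
      (∀ t ∈ timeInterval T,
        ‖Sobolev.incl (show N ≤ n + 2 by omega) (u t)‖ ^ 2
          = 2 * (Sobolev.incl (show N ≤ n + 2 by omega) (u t)).energy) ∧
      ∀ t : ℝ, 0 ≤ t → (t : EReal) ≤ T →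
        BddAbove ((fun τ => (Sobolev.incl (show N ≤ n + 2 by omega) (u τ)).energy) '' Ico 0 t) := by
  refine fun N hN => ⟨fun t _ => norm_sq_eq_two_mul_energy _, fun t ht0 ht => ?_⟩
  obtain ⟨B, hB0, hB⟩ := hu.exists_bound ht
    ((lintegral_mono fun τ => maxNorm_incl_mono hm (by omega) (u τ)).trans_lt (hk t ht0 ht))
    -- The step index `n - 1` controls all orders up to `n`; it is legitimate since `n ≥ 1`.
    (n - 1) (by omega)
  refine ⟨∑ _j : Fin (N + 1), B ^ 2, ?_⟩
  rintro _ ⟨τ, hτ, rfl⟩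
  have h1 := norm_sq_eq_two_mul_energy (incl (show N ≤ n + 2 by omega) (u τ))
  have h2 : ‖incl (show N ≤ n + 2 by omega) (u τ)‖ ^ 2 ≤ ∑ _j : Fin (N + 1), B ^ 2 := by
    rw [norm_sq_eq_sum]
    refine Finset.sum_le_sum fun j _ => ?_
    rw [← jet_apply j.2, jet_incl _ (by omega)]
    exact pow_le_pow_left₀ (norm_nonneg _) (hB τ hτ j (by omega)) 2
  have h3 := sq_nonneg ‖incl (show N ≤ n + 2 by omega) (u τ)‖
  simp only
  linarith
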